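/- Let $n\ge 1$, let $\Omega=dz_1\wedge\dots\wedge dz_n$ on $\mathbb C^n$, let $T^n=\{z\in\mathbb C^n: |z_j|=1,\ 1\le j\le n\}$ be the standard torus, and for $r>0$ let $A_r=\{z\in\mathbb C^n: e^{-r}<|z_j|<e^{r},\ 1\le j\le n\}$ and $\|a\|_r=\sup_{z\in A_r}|a(z)|$. For an immersion $\varphi\colon T^n\to\mathbb C^n$ put $\omega_\varphi=\varphi^*\Omega$. The immersion $\varphi$ is called totally real if $\omega_\varphi$ vanishes at no point of $T^n$. In that case $\omega_\varphi=\tau\,\nu$ for a unique map $\tau\colon T^n\to S^1=\{\lambda\in\mathbb C:|\lambda|=1\}$ and a unique volume form $\nu$ on $T^n$, positive with respect to the orientation $d\theta_1\wedge\dots\wedge d\theta_n$, where $z_j=e^{i\theta_j}$ on $T^n$; a totally real immersion $\varphi$ is called non-critical if $\tau$ is a submersion. **Theorem.** There is a number $\epsilon>0$, depending only on $n$, such that the following holds for every $r_0$ with $0<r_0<1$. Let $a$ be a holomorphic function on $A_{r_0}$ with $\|a\|_{r_0}\le\epsilon\, r_0$, and let $\omega$ be the complex-valued $n$-form on $T^n$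 obtained by restricting $(1+a(z))\,\Omega$ to $T^n$. If $\int_{T^n}\omega=0$, then there is a totally real and non-critical real analytic embedding $\varphi\colon T^n\to\mathbb C^n$ such that $\omega=\omega_\varphi=\varphi^*\Omega$ on $T^n$. -/

import Mathlib

open scoped ContDiff ENNReal

namespace UnimodularTorus

/-- The standard torus `Tⁿ`, the set of `z ∈ ℂⁿ` with `|z_j| = 1` for all `j`, as the product of
`n` circles. -/
abbrev Torus (n : ℕ) : Type := Fin n → Circle

/-- The inclusion `Tⁿ → ℂⁿ`. -/
def incl {n : ℕ} (p : Torus n) : Fin n → ℂ := fun j => (p j : ℂ)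

/-- The universal covering `ℝⁿ → Tⁿ`, `(θ₁, …, θₙ) ↦ (e^{iθ₁}, …, e^{iθₙ})`. It is a local
diffeomorphism, and its local inverses are the (real analytic) angular charts of `Tⁿ`. -/
noncomputable def cover {n : ℕ} (θ : Fin n → ℝ) : Torus n := fun j => Circle.exp (θ j)

/-- A map on `Tⁿ`, written in the angular coordinates `θ₁, …, θₙ`. -/
noncomputable def lift {n : ℕ} {X : Type*} (f : Torus n → X) : (Fin n → ℝ) → X :=
  fun θ => f (cover θ)

/-- The differential at `cover θ` of a map `Tⁿ → ℂⁿ`. The tangent space of `Tⁿ` at `cover θ` is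
identified with `ℝⁿ` through the frame `∂/∂θ₁, …, ∂/∂θₙ`. -/
noncomputable def differential {n : ℕ} (φ : Torus n → (Fin n → ℂ)) (θ : Fin n → ℝ) :
    (Fin n → ℝ) →L[ℝ] (Fin n → ℂ) :=
  fderiv ℝ (lift φ) θ

/-- A real analytic embedding `Tⁿ → ℂⁿ`: a real analytic immersion which is a homeomorphism onto
its image. -/
structure IsAnalyticEmbedding {n : ℕ} (φ : Torus n → (Fin n → ℂ)) : Prop where
  analytic : AnalyticOnNhd ℝ (lift φ) Set.univ
  immersion : ∀ θ, Function.Injective (differential φ θ)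
  embedding : Topology.IsEmbedding φ

/-- The holomorphic `n`-form `Ω = dz₁ ∧ … ∧ dzₙ` on `ℂⁿ`: its value on `v₁, …, vₙ` is
`det (dz_j (v_i))`. -/
noncomputable def Omega (n : ℕ) : (Fin n → ℂ) [⋀^Fin n]→ₗ[ℂ] ℂ := Matrix.detRowAlternating

/-- The real `n`-form `dθ = dθ₁ ∧ … ∧ dθₙ`, the standard volume form on `Tⁿ`. -/
noncomputable def dTheta (n : ℕ) : (Fin n → ℝ) [⋀^Fin n]→ₗ[ℝ] ℝ := Matrix.detRowAlternating

/-- Complex-valued `n`-forms on `Tⁿ` in angular coordinates: the value at `θ` is an alternating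
form on the tangent space at `cover θ`, which is identified with `ℝⁿ` through the frame
`∂/∂θ₁, …, ∂/∂θₙ`. -/
abbrev TorusForm (n : ℕ) : Type := (Fin n → ℝ) → ((Fin n → ℝ) [⋀^Fin n]→ₗ[ℝ] ℂ)

/-- The pullback `φ^* η` to `Tⁿ` of a complex `n`-form `η` of type `(n, 0)` under
`φ : Tⁿ → ℂⁿ`. -/
noncomputable def pullback {n : ℕ} (φ : Torus n → (Fin n → ℂ))
    (η : (Fin n → ℂ) → ((Fin n → ℂ) [⋀^Fin n]→ₗ[ℂ] ℂ)) : TorusForm n := fun θ =>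
  { toFun := fun v => η (lift φ θ) (fun i => differential φ θ (v i))
    map_update_add' := by
      intro _ v i x y
      have h : ∀ w, (fun k => differential φ θ (Function.update v i w k)) =
          Function.update (fun k => differential φ θ (v k)) i (differential φ θ w) := by
        intro w; ext1 k; by_cases hk : k = i
        · subst hk; simp
        · simp [hk]
      have e : ‹DecidableEq (Fin n)› = instDecidableEqFin n := Subsingleton.elim _ _
      subst e
      simp only [h, map_add, AlternatingMap.map_update_add]
    map_update_smul' := by
      intro _ v i c x
      have h : ∀ w, (fun k => differential φ θ (Function.update v i w k)) =
          Function.update (fun k => differential φ θ (v k)) i (differential φ θ w) := by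
        intro w; ext1 k; by_cases hk : k = i
        · subst hk; simp
        · simp [hk]
      have e : ‹DecidableEq (Fin n)› = instDecidableEqFin n := Subsingleton.elim _ _
      subst e
      have hc : ∀ w : Fin n → ℂ, c • w = (c : ℂ) • w := by
        intro w; ext k; simp
      simp only [h, map_smul, hc, AlternatingMap.map_update_smul]
      simp
    map_eq_zero_of_eq' := by
      intro v i j hv hij
      exact (η (lift φ θ)).map_eq_zero_of_eq _ (by simp [hv]) hij }

/-- The integral of a complex-valued `n`-form over `Tⁿ`, oriented by `dθ`. -/
noncomputable def integral {n : ℕ} (η : TorusForm n) : ℂ :=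
  ∫ θ in Set.Icc (0 : Fin n → ℝ) (fun _ => 2 * Real.pi), η θ (fun j => Pi.single j 1)

/-- `ω_φ = φ^* Ω`. -/
noncomputable def omegaOf {n : ℕ} (φ : Torus n → (Fin n → ℂ)) : TorusForm n :=
  pullback φ (fun _ => Omega n)

/-- `φ` is totally real if `ω_φ` vanishes at no point. -/
def IsTotallyReal {n : ℕ} (φ : Torus n → (Fin n → ℂ)) : Prop :=
  ∀ θ, omegaOf φ θ ≠ 0

/-- A smooth map `τ : Tⁿ → S¹` is a submersion if at every point its differential maps onto the
tangent line `T_τ S¹ = ℝ · iτ`. -/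
def IsSubmersion {n : ℕ} (τ : Torus n → Circle) : Prop :=
  ContDiff ℝ ∞ (lift fun p => (τ p : ℂ)) ∧
    ∀ θ, LinearMap.range
        (fderiv ℝ (lift fun p => (τ p : ℂ)) θ : (Fin n → ℝ) →ₗ[ℝ] ℂ) =
      Submodule.span ℝ {Complex.I * (τ (cover θ) : ℂ)}

/-- `φ` is non-critical if in the decomposition `ω_φ = τ ν`, with `τ = e^{iμ}` of modulus one and
`ν = ρ dθ` a (positive) volume form, the map `τ : Tⁿ → S¹` is a submersion. The pair `(τ, ρ)` is
uniquely determined by `ω_φ`. -/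
def IsNonCritical {n : ℕ} (φ : Torus n → (Fin n → ℂ)) : Prop :=
  ∃ (τ : Torus n → Circle) (ρ : Torus n → ℝ), (∀ p, 0 < ρ p) ∧
    (∀ θ v, omegaOf φ θ v = (τ (cover θ) : ℂ) * ((ρ (cover θ) * dTheta n v : ℝ) : ℂ)) ∧
    IsSubmersion τ

/-- The annulus `A_r = {z ∈ ℂⁿ : e^{-r} < |z_j| < e^r for all j}`. -/
def annulus (n : ℕ) (r : ℝ) : Set (Fin n → ℂ) :=
  {z | ∀ j, Real.exp (-r) < ‖z j‖ ∧ ‖z j‖ < Real.exp r}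

/-- The norm `‖a‖_r = sup {|a(z)| : z ∈ A_r}`, with values in `[0, ∞]`. -/
noncomputable def annulusNorm {n : ℕ} (r : ℝ) (a : (Fin n → ℂ) → ℂ) : ℝ≥0∞ :=
  ⨆ z ∈ annulus n r, ‖a z‖ₑ

/-- The restriction to `Tⁿ` of the form `(1 + a(z)) Ω`. -/
noncomputable def perturbedForm {n : ℕ} (a : (Fin n → ℂ) → ℂ) : TorusForm n :=
  pullback incl (fun z => (1 + a z) • Omega n)

end UnimodularTorus

/-!
Write `H dθ` for the density of a form on the torus in angular coordinates, divided by `iⁿ`. For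
`(1 + a) Ω` this is `H = (1 + a) osc` with `osc = z₁ ⋯ zₙ`, and the theorem asks for an embedding
`φ` with Jacobian determinant `iⁿ H`. Only two consequences of the bound on `a` are used: `H` is
uniformly close to `osc` on the torus, and (by Cauchy's estimate) `∂a/∂θ_l` is small there. The
latter makes the phase of the form a submersion (`isNonCritical_of_small`).

If the means of `H` over one angle `θ_l` all vanish, then `H` has a periodic primitive `Q` in the
direction `θ_l`. The map with components `e^{iθ_k}` for `k ≠ l` and a multiple of `Q` for `k = l`
has a triangular Jacobian matrix with the right determinant, and it is injective because `H` is
close to `osc` (`realizable_of_mean_eq_zero`).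

In general the density is first transported by diffeomorphisms of the torus
(`Realizable.of_shear`) which change one angle `θ_j`, `j ≠ l`, by `s = Re (t̄ e^{iθ_l})`, where
`t` does not depend on `θ_l`. The mean of the new density over `θ_l` becomes that of `H`, averaged
over `θ_j`, if `t` solves a complex equation at each point. In terms of a periodic primitive of
`H` in the direction `θ_j` this is the equation `defect = 0`, in which no derivative of `t`
occurs. For `H = osc` its linear part is an isomorphism, so for `H` close to `osc` it has a unique
small solution (`norm_defect_sub_add_le`, `exists_defect_eq_zero`), which is real analytic by the
inverse function theorem; differentiating the equation shows that the derivative of `s` in the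
direction `θ_j` is small too, so that the new density is still close to `osc` (`exists_shear`). No
derivatives are lost, since closeness to `osc` is always measured in the uniform norm. After the
shears in all angles other than `θ_l`, the mean over `θ_l` is constant, and the constant is a
multiple of the integral of `H`, which is zero (`exists_mean_independent`, `exists_realizable`).

Real analyticity is carried along by two facts: a compact integral of a jointly analytic function
is analytic in the parameter (`analyticAt_setIntegral`, which also gives the analyticity of
holomorphic functions of several variables through Cauchy's formula), and an injective analytic map
with invertible derivative has an analytic inverse (`analyticAt_of_comp_injOn`).
-/

namespace UnimodularTorus

open MeasureTheory Topology Filter Set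

/-! ### Integrals of real analytic functions depending on a parameter -/

section Parametric

variable {E Y Z : Type*} [NormedAddCommGroup E] [NormedSpace ℝ E]
  [NormedAddCommGroup Y] [NormedSpace ℝ Y] [NormedAddCommGroup Z] [NormedSpace ℝ Z]

/-- Composition with a fixed continuous multilinear map, acting pointwise on continuous functions
on a compact space. -/
noncomputable def pointwiseMultilinear (L : Type*) [TopologicalSpace L] [CompactSpace L] {m : ℕ}
    (P : ContinuousMultilinearMap ℝ (fun _ : Fin m => Z) ℂ) :
    ContinuousMultilinearMap ℝ (fun _ : Fin m => C(L, Z)) C(L, ℂ) :=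
  MultilinearMap.mkContinuous
    { toFun := fun u => ⟨fun y => P fun i => u i y, by fun_prop⟩
      map_update_add' := by
        intro _ u i f g
        ext y
        have h : ∀ w : C(L, Z), (fun k => (Function.update u i w k) y) =
            Function.update (fun k => u k y) i (w y) := by
          intro w; ext1 k; by_cases hk : k = i
          · subst hk; simp
          · simp [hk]
        have e : ‹DecidableEq (Fin m)› = instDecidableEqFin m := Subsingleton.elim _ _
        subst e
        simp [h]
      map_update_smul' := by
        intro _ u i c f
        ext y
        have h : ∀ w : C(L, Z), (fun k => (Function.update u i w k) y) =
            Function.update (fun k => u k y) i (w y) := by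
          intro w; ext1 k; by_cases hk : k = i
          · subst hk; simp
          · simp [hk]
        have e : ‹DecidableEq (Fin m)› = instDecidableEqFin m := Subsingleton.elim _ _
        subst e
        simp [h] }
    ‖P‖ (by
      intro u
      rw [ContinuousMap.norm_le _ (by positivity)]
      intro y
      refine (P.le_opNorm _).trans ?_
      gcongr with i
      exact ContinuousMap.norm_coe_le_norm (u i) y)

/-- The superposition operator `u ↦ k ∘ u` of a function `k` analytic at `z₀` is analytic as a map
of Banach spaces of continuous functions, near the constant function `z₀`. -/
theorem exists_analytic_superposition (L : Type*) [TopologicalSpace L] [CompactSpace L]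
    {k : Z → ℂ} {r : ℝ≥0∞} {p : FormalMultilinearSeries ℝ Z ℂ} {z₀ : Z}
    (hk : HasFPowerSeriesOnBall k p z₀ r) :
    ∃ N : C(L, Z) → C(L, ℂ),
      AnalyticOnNhd ℝ N (Metric.eball (ContinuousMap.const L z₀) r) ∧
      ∀ u ∈ Metric.eball (ContinuousMap.const L z₀) r, ∀ y, N u y = k (u y) := by
  let P : FormalMultilinearSeries ℝ C(L, Z) C(L, ℂ) := fun m => pointwiseMultilinear L (p m)
  have hP : r ≤ P.radius := hk.r_le.trans (FormalMultilinearSeries.radius_le_of_le fun m =>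
    MultilinearMap.mkContinuous_norm_le _ (norm_nonneg _) _)
  have hs := (P.hasFPowerSeriesOnBall (hk.r_pos.trans_le hP)).mono hk.r_pos hP
  refine ⟨fun u => P.sum (u - ContinuousMap.const L z₀), ?_, ?_⟩
  · intro u hu
    have h1 : AnalyticAt ℝ P.sum (u - ContinuousMap.const L z₀) := by
      apply hs.analyticAt_of_mem
      simpa [Metric.mem_eball, edist_eq_enorm_sub] using! hu
    exact h1.comp_of_eq (analyticAt_id.sub analyticAt_const) rfl
  · intro u hu y
    have hu' : u - ContinuousMap.const L z₀ ∈ Metric.eball (0 : C(L, Z)) r := by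
      simpa [Metric.mem_eball, edist_eq_enorm_sub] using! hu
    have h1 := (hs.hasSum hu').map (ContinuousMap.evalCLM ℝ y) (ContinuousLinearMap.continuous _)
    have hy : u y - z₀ ∈ Metric.eball (0 : Z) r := by
      simp only [Metric.mem_eball, edist_zero_right] at hu' ⊢
      refine lt_of_le_of_lt ?_ hu'
      have := ContinuousMap.norm_coe_le_norm (u - ContinuousMap.const L z₀) y
      simpa [enorm_le_iff_norm_le] using this
    have h2 := hk.hasSum hy
    rw [add_sub_cancel] at h2
    refine HasSum.unique ?_ h2
    rw [zero_add] at h1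
    exact h1

variable [FiniteDimensional ℝ Y] [MeasurableSpace Y] [BorelSpace Y]

/-- Local form of `analyticAt_setIntegral`, over a neighbourhood of one point of the domain of
integration. -/
theorem exists_nhds_analyticAt_integral {k : E × Y → ℂ} {x₀ : E} {y₀ : Y}
    (hk : AnalyticAt ℝ k (x₀, y₀)) (μ : Measure Y) :
    ∃ B ∈ 𝓝 y₀, MeasurableSet B ∧ ∀ g : Y → ℂ, Integrable g μ →
      (∀ᶠ x in 𝓝 x₀, IntegrableOn (fun y => g y * k (x, y)) B μ) ∧
      AnalyticAt ℝ (fun x => ∫ y in B, g y * k (x, y) ∂μ) x₀ := by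
  obtain ⟨p, r, hp⟩ := hk
  obtain ⟨ρ, hρ, hρr⟩ := ENNReal.lt_iff_exists_nnreal_btwn.1 hp.r_pos
  have hρ0 : (0 : ℝ) < ρ := by exact_mod_cast hρ
  let L := Metric.closedBall y₀ (ρ / 2 : ℝ)
  have hLc : CompactSpace L := isCompact_iff_compactSpace.1 (isCompact_closedBall _ _)
  have hLm : MeasurableSet L := Metric.isClosed_closedBall.measurableSet
  obtain ⟨N, hN, hNk⟩ := exists_analytic_superposition L hp
  refine ⟨L, Metric.closedBall_mem_nhds _ (by positivity), hLm, ?_⟩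
  -- the affine map sending `x` to the function `y ↦ (x, y)`
  let w : C(L, E × Y) := ⟨fun y => (0, y), by fun_prop⟩
  let U : E → C(L, E × Y) := fun x =>
    (ContinuousLinearMap.const L (R := ℝ) (M := E × Y)) ((ContinuousLinearMap.inl ℝ E Y) x) + w
  have hUa : ∀ x, AnalyticAt ℝ U x := fun x =>
    (((ContinuousLinearMap.const L (R := ℝ) (M := E × Y)).comp
      (ContinuousLinearMap.inl ℝ E Y)).analyticAt x).add analyticAt_const
  have hU : ∀ x y, U x y = (x, (y : Y)) := by intro x y; simp [U, w]
  have hmem : ∀ x ∈ Metric.ball x₀ (ρ / 2 : ℝ),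
      U x ∈ Metric.eball (ContinuousMap.const L (x₀, y₀)) r := by
    intro x hx
    rw [Metric.mem_eball]
    refine lt_of_le_of_lt ?_ hρr
    rw [edist_dist, ← ENNReal.ofReal_coe_nnreal]
    apply ENNReal.ofReal_le_ofReal
    rw [ContinuousMap.dist_le (by positivity)]
    intro y
    rw [hU, ContinuousMap.const_apply, Prod.dist_eq]
    have h1 := Metric.mem_ball.1 hx
    have h2 : dist (y : Y) y₀ ≤ ρ / 2 := y.2
    apply max_le <;> simp only <;> linarith
  intro g hg
  -- integration against `g` is a continuous functional on `C(L, ℂ)`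
  have hint : ∀ f : C(L, ℂ), Integrable (fun y : L => g y * f y) (μ.comap (↑)) := by
    intro f
    have hg' : Integrable (fun y : L => g y) (μ.comap (↑)) :=
      (integrableOn_iff_comap_subtypeVal hLm).1 hg.integrableOn
    exact hg'.mul_bdd (c := ‖f‖) f.continuous.aestronglyMeasurable
      (Eventually.of_forall fun y => f.norm_coe_le_norm y)
  have hg' : Integrable (fun y : L => g y) (μ.comap (↑)) :=
    (integrableOn_iff_comap_subtypeVal hLm).1 hg.integrableOn
  let Λ : C(L, ℂ) →L[ℝ] ℂ := LinearMap.mkContinuous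
    { toFun := fun f => ∫ y : L, g y * f y ∂(μ.comap (↑))
      map_add' := by
        intro f f'
        simp only [ContinuousMap.add_apply, mul_add]
        exact integral_add (hint f) (hint f')
      map_smul' := by
        intro c f
        simp only [ContinuousMap.smul_apply, RingHom.id_apply]
        rw [← integral_smul]
        congr 1; ext y; simp; ring }
    (∫ y : L, ‖g y‖ ∂(μ.comap (↑))) (by
      intro f
      refine (norm_integral_le_integral_norm _).trans ?_
      rw [← integral_mul_const]
      refine integral_mono (hint f).norm (hg'.norm.mul_const _) fun y => ?_
      simp only [norm_mul]
      gcongr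
      exact f.norm_coe_le_norm y)
  have hΛ : ∀ f, Λ f = ∫ y : L, g y * f y ∂(μ.comap (↑)) := fun f => rfl
  have hnear : ∀ᶠ x in 𝓝 x₀, x ∈ Metric.ball x₀ (ρ / 2 : ℝ) :=
    Metric.ball_mem_nhds _ (by positivity)
  refine ⟨?_, ?_⟩
  · filter_upwards [hnear] with x hx
    rw [integrableOn_iff_comap_subtypeVal hLm]
    refine (hint (N (U x))).congr (Eventually.of_forall fun y => ?_)
    simp only [Function.comp]
    rw [hNk _ (hmem x hx), hU]
  · have h1 : AnalyticAt ℝ (fun x => Λ (N (U x))) x₀ := by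
      have h2 : AnalyticAt ℝ N (U x₀) := hN _ (hmem x₀ (Metric.mem_ball_self (by positivity)))
      exact (Λ.analyticAt _).comp (h2.comp (hUa x₀))
    refine h1.congr ?_
    filter_upwards [hnear] with x hx
    rw [hΛ, ← integral_subtype_comap hLm]
    congr 1; ext y
    rw [hNk _ (hmem x hx), hU]

/-- An integral `∫_K g(y) k(x, y) dy` over a compact set is a real analytic function of the
parameter `x` if `k` is jointly real analytic, whatever the integrable weight `g`. -/
theorem analyticAt_setIntegral {k : E × Y → ℂ} {x₀ : E} {K : Set Y} (hK : IsCompact K)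
    (hk : ∀ y ∈ K, AnalyticAt ℝ k (x₀, y)) {μ : Measure Y} {g : Y → ℂ}
    (hg : IntegrableOn g K μ) :
    AnalyticAt ℝ (fun x => ∫ y in K, g y * k (x, y) ∂μ) x₀ := by
  have key : ∃ B ⊇ K, MeasurableSet B ∧ ∀ g : Y → ℂ, Integrable g (μ.restrict K) →
      (∀ᶠ x in 𝓝 x₀, IntegrableOn (fun y => g y * k (x, y)) B (μ.restrict K)) ∧
      AnalyticAt ℝ (fun x => ∫ y in B, g y * k (x, y) ∂(μ.restrict K)) x₀ := by
    refine hK.induction_on (p := fun s => ∃ B ⊇ s, MeasurableSet B ∧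
      ∀ g : Y → ℂ, Integrable g (μ.restrict K) →
      (∀ᶠ x in 𝓝 x₀, IntegrableOn (fun y => g y * k (x, y)) B (μ.restrict K)) ∧
      AnalyticAt ℝ (fun x => ∫ y in B, g y * k (x, y) ∂(μ.restrict K)) x₀) ?_ ?_ ?_ ?_
    · exact ⟨∅, le_rfl, MeasurableSet.empty, fun g _ => by
        simpa using analyticAt_const⟩
    · rintro s t hst ⟨B, hB, h⟩
      exact ⟨B, hst.trans hB, h⟩
    · rintro s t ⟨B, hB, hBm, h⟩ ⟨B', hB', hBm', h'⟩
      refine ⟨B ∪ B', union_subset_union hB hB', hBm.union hBm', fun g hg => ?_⟩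
      obtain ⟨h1, h2⟩ := h g hg
      obtain ⟨h3, h4⟩ := h' (Bᶜ.indicator g) (hg.indicator hBm.compl)
      have e : ∀ x y, Bᶜ.indicator g y * k (x, y) = Bᶜ.indicator (fun y => g y * k (x, y)) y := by
        intro x y; by_cases hy : y ∈ Bᶜ <;> simp [hy]
      have hdiff : ∀ᶠ x in 𝓝 x₀,
          IntegrableOn (fun y => g y * k (x, y)) (B' \ B) (μ.restrict K) := by
        filter_upwards [h3] with x hx
        simp only [e] at hx
        rw [IntegrableOn, integrable_indicator_iff hBm.compl, IntegrableOn,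
          Measure.restrict_restrict hBm.compl, inter_comm] at hx
        exact hx
      have hu : B ∪ B' = B ∪ (B' \ B) := by simp
      refine ⟨?_, ?_⟩
      · filter_upwards [h1, hdiff] with x hx hx'
        rw [hu]; exact hx.union hx'
      · refine (h2.add h4).congr ?_
        filter_upwards [h1, hdiff] with x hx hx'
        rw [hu, setIntegral_union disjoint_sdiff_right (hBm'.diff hBm) hx hx']
        simp only [Pi.add_apply, e, setIntegral_indicator hBm.compl]
        rfl
    · intro y hy
      obtain ⟨B, hB, hBm, h⟩ := exists_nhds_analyticAt_integral (hk y hy) (μ.restrict K)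
      exact ⟨B, mem_nhdsWithin_of_mem_nhds hB, B, le_rfl, hBm, h⟩
  obtain ⟨B, hB, hBm, h⟩ := key
  have := (h g hg).2
  rwa [show (μ.restrict K).restrict B = μ.restrict K by
    rw [Measure.restrict_restrict hBm, inter_eq_self_of_subset_right hB]] at this

theorem analyticOnNhd_intervalIntegral {k : E × ℝ → ℂ} (hk : AnalyticOnNhd ℝ k univ)
    {a b : ℝ} (hab : a ≤ b) : AnalyticOnNhd ℝ (fun x => ∫ y in a..b, k (x, y)) univ := by
  intro x _
  have := analyticAt_setIntegral (isCompact_Icc (a := a) (b := b)) (x₀ := x)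
    (fun y _ => hk (x, y) trivial) (μ := volume) (g := fun _ => 1) (by simp)
  simpa [intervalIntegral.integral_of_le hab, integral_Icc_eq_integral_Ioc] using this

end Parametric

/-! ### Inverting analytic maps -/

/-- If `Ψ` is analytic and injective with invertible derivative on an open set `U`, then a map `g`
into `U` is analytic as soon as `Ψ ∘ g` is; no continuity of `g` is required. -/
theorem analyticAt_of_comp_injOn {X E : Type*} [NormedAddCommGroup X] [NormedSpace ℝ X]
    [NormedAddCommGroup E] [NormedSpace ℝ E] [FiniteDimensional ℝ E]
    {Ψ : E → E} {U : Set E} (hU : IsOpen U) (hΨ : AnalyticOnNhd ℝ Ψ U) (hinj : InjOn Ψ U)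
    (hder : ∀ x ∈ U, Function.Injective (fderiv ℝ Ψ x)) {g : X → E} (hg : ∀ x, g x ∈ U)
    {x₀ : X} (h : AnalyticAt ℝ (fun x => Ψ (g x)) x₀) : AnalyticAt ℝ g x₀ := by
  have hcomplete : CompleteSpace E := FiniteDimensional.complete ℝ E
  have ha := hΨ _ (hg x₀)
  let i : E ≃L[ℝ] E := (LinearEquiv.ofInjectiveEndo
    (fderiv ℝ Ψ (g x₀) : E →ₗ[ℝ] E) (hder _ (hg x₀))).toContinuousLinearEquiv
  have hi : (i : E →L[ℝ] E) = fderiv ℝ Ψ (g x₀) := by ext v; simp [i]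
  have hstrict : HasStrictFDerivAt Ψ (i : E →L[ℝ] E) (g x₀) := by
    rw [hi]; exact ha.hasStrictFDerivAt
  let f := hstrict.toOpenPartialHomeomorph Ψ
  have hmem : g x₀ ∈ f.source := hstrict.mem_toOpenPartialHomeomorph_source
  obtain ⟨p, hp⟩ := ha
  have hp1 : p 1 = (continuousMultilinearCurryFin1 ℝ E E).symm (i : E →L[ℝ] E) := by
    rw [hi, hp.fderiv_eq]; simp
  have hsymm : AnalyticAt ℝ f.symm (Ψ (g x₀)) :=
    (f.hasFPowerSeriesAt_symm hmem hp hp1).analyticAt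
  refine (AnalyticAt.comp (g := f.symm) (f := fun x => Ψ (g x)) hsymm h).congr ?_
  have htarget : ∀ᶠ w in 𝓝 (Ψ (g x₀)), w ∈ f.target ∧ f.symm w ∈ U := by
    have h1 : f.target ∈ 𝓝 (Ψ (g x₀)) := f.open_target.mem_nhds (f.map_source hmem)
    have h2 : Tendsto f.symm (𝓝 (Ψ (g x₀))) (𝓝 (g x₀)) := by
      have := f.tendsto_symm hmem
      exact this
    exact (eventually_mem_set.2 h1).and (h2.eventually (hU.mem_nhds (hg x₀)))
  filter_upwards [h.continuousAt.eventually htarget] with x hx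
  apply hinj hx.2 (hg x)
  exact f.right_inv hx.1

/-! ### Holomorphic functions of several variables are analytic -/

section Cauchy

open scoped Real

theorem norm_torusMap_sub {n : ℕ} (c : Fin n → ℂ) {R : Fin n → ℝ} (hR : ∀ i, 0 < R i)
    (θ : Fin n → ℝ) (i : Fin n) : ‖torusMap c R θ i - c i‖ = R i := by
  simp [torusMap, abs_of_pos (hR i)]

theorem continuous_torusMap {n : ℕ} (c : Fin n → ℂ) (R : Fin n → ℝ) :
    Continuous (torusMap c R) := by
  unfold torusMap; fun_prop

theorem torusMap_ne {n : ℕ} {c w : Fin n → ℂ} {R : Fin n → ℝ} (hR : ∀ i, 0 < R i)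
    (hw : ∀ i, ‖w i - c i‖ < R i) (θ : Fin n → ℝ) (i : Fin n) :
    torusMap c R θ i - w i ≠ 0 := by
  intro h
  have h1 := norm_torusMap_sub c hR θ i
  rw [sub_eq_zero.1 h] at h1
  exact (hw i).ne h1

/-- Cauchy's formula on a polydisc. -/
theorem torusIntegral_cauchy {n : ℕ} {f : (Fin n → ℂ) → ℂ} {c w : Fin n → ℂ} {R : Fin n → ℝ}
    {U : Set (Fin n → ℂ)} (hU : IsOpen U) (hf : DifferentiableOn ℂ f U) (hR : ∀ i, 0 < R i)
    (hRU : ∀ z : Fin n → ℂ, (∀ i, ‖z i - c i‖ ≤ R i) → z ∈ U) (hw : ∀ i, ‖w i - c i‖ < R i) :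
    (∯ ζ in T(c, R), (∏ i, (ζ i - w i)⁻¹) * f ζ) = (2 * π * Complex.I) ^ n * f w := by
  induction n with
  | zero =>
    rw [torusIntegral_dim0]
    simp [Subsingleton.elim w c]
  | succ n ih =>
    have hint : TorusIntegrable (fun ζ => (∏ i, (ζ i - w i)⁻¹) * f ζ) c R := by
      apply ContinuousOn.integrableOn_compact isCompact_Icc
      apply Continuous.continuousOn
      have h1 := continuous_torusMap c R
      apply Continuous.mul
      · apply continuous_finsetProd
        intro i _
        exact Continuous.inv₀ (by fun_prop) (fun θ => torusMap_ne hR hw θ i)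
      · exact hf.continuousOn.comp_continuous h1
          fun θ => hRU _ fun i => (norm_torusMap_sub c hR θ i).le
    rw [torusIntegral_succ hint]
    have hcons : ∀ x : ℂ,
        Differentiable ℂ fun y : Fin n → ℂ => (Fin.cons x y : Fin (n + 1) → ℂ) := by
      intro x
      rw [differentiable_pi]
      intro i
      refine Fin.cases ?_ (fun i => ?_) i
      · simp
      · simp only [Fin.cons_succ]; fun_prop
    have hcons' : ∀ y : Fin n → ℂ,
        Differentiable ℂ fun x : ℂ => (Fin.cons x y : Fin (n + 1) → ℂ) := by
      intro y
      rw [differentiable_pi]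
      intro i
      refine Fin.cases ?_ (fun i => ?_) i
      · simp
      · simp
    have hinner : ∀ x ∈ Metric.sphere (c 0) (R 0),
        (∯ y in T(c ∘ Fin.succ, R ∘ Fin.succ), (∏ i, ((Fin.cons x y : Fin (n + 1) → ℂ) i - w i)⁻¹) *
          f (Fin.cons x y)) =
        (2 * π * Complex.I) ^ n * ((x - w 0)⁻¹ * f (Fin.cons x (w ∘ Fin.succ))) := by
      intro x hx
      have := ih (f := fun y => f (Fin.cons x y)) (c := c ∘ Fin.succ) (w := w ∘ Fin.succ)
        (R := R ∘ Fin.succ) (U := {y | (Fin.cons x y : Fin (n + 1) → ℂ) ∈ U})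
        (hU.preimage (hcons x).continuous)
        (hf.comp (hcons x).differentiableOn fun y hy => hy) (fun i => hR _)
        (fun z hz => hRU _ fun i => by
          refine Fin.cases ?_ (fun i => ?_) i
          · simpa using (mem_sphere_iff_norm.1 hx).le
          · simpa using hz i) (fun i => hw _)
      simp only [Fin.prod_univ_succ, Fin.cons_zero, Fin.cons_succ, mul_assoc]
      rw [torusIntegral_const_mul]
      simp only [Function.comp] at this ⊢
      rw [this]
      ring
    rw [circleIntegral.integral_congr (hR 0).le hinner, circleIntegral.integral_const_mul]
    have h1 : DifferentiableOn ℂ (fun x => f (Fin.cons x (w ∘ Fin.succ)))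
        (Metric.closedBall (c 0) (R 0)) := by
      refine hf.comp (hcons' _).differentiableOn fun x hx => hRU _ fun i => ?_
      refine Fin.cases ?_ (fun i => ?_) i
      · simpa using mem_closedBall_iff_norm.1 hx
      · simpa using (hw i.succ).le
    have h2 := h1.circleIntegral_sub_inv_smul (w := w 0) (mem_ball_iff_norm.2 (hw 0))
    simp only [smul_eq_mul] at h2
    rw [h2]
    have : (Fin.cons (w 0) (w ∘ Fin.succ) : Fin (n + 1) → ℂ) = w := Fin.cons_self_tail w
    rw [this]
    ring

theorem analyticAt_cexp_comp {E : Type*} [NormedAddCommGroup E] [NormedSpace ℝ E] {f : E → ℂ}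
    {x : E} (hf : AnalyticAt ℝ f x) : AnalyticAt ℝ (fun x => Complex.exp (f x)) x :=
  AnalyticAt.comp (g := Complex.exp) (analyticAt_cexp.restrictScalars) hf

theorem analyticAt_coord {n : ℕ} {E : Type*} [NormedAddCommGroup E] [NormedSpace ℝ E]
    {F : Type*} [NormedAddCommGroup F] [NormedSpace ℝ F]
    {f : E → Fin n → F} {x : E} (hf : AnalyticAt ℝ f x) (i : Fin n) :
    AnalyticAt ℝ (fun x => f x i) x :=
  ((ContinuousLinearMap.proj (R := ℝ) (φ := fun _ : Fin n => F) i).analyticAt _).comp hf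

theorem analyticAt_ofReal {E : Type*} [NormedAddCommGroup E] [NormedSpace ℝ E]
    {f : E → ℝ} {x : E} (hf : AnalyticAt ℝ f x) : AnalyticAt ℝ (fun x => (f x : ℂ)) x :=
  (Complex.ofRealCLM.analyticAt _).comp hf

/-- Only analyticity over `ℝ` is recorded, since only the restriction to the torus matters. -/
theorem analyticOnNhd_of_differentiableOn {n : ℕ} {f : (Fin n → ℂ) → ℂ} {U : Set (Fin n → ℂ)}
    (hU : IsOpen U) (hf : DifferentiableOn ℂ f U) : AnalyticOnNhd ℝ f U := by
  intro c hc
  obtain ⟨r, hr, hrU⟩ := Metric.isOpen_iff.1 hU c hc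
  let R : Fin n → ℝ := fun _ => r / 2
  have hR : ∀ i, 0 < R i := fun _ => by positivity
  have hRU : ∀ z : Fin n → ℂ, (∀ i, ‖z i - c i‖ ≤ R i) → z ∈ U := by
    intro z hz
    apply hrU
    rw [Metric.mem_ball, dist_pi_lt_iff hr]
    intro i
    rw [dist_eq_norm]
    exact (hz i).trans_lt (half_lt_self hr)
  let k : (Fin n → ℂ) × (Fin n → ℝ) → ℂ := fun q => ∏ i, (torusMap c R q.2 i - q.1 i)⁻¹
  let g : (Fin n → ℝ) → ℂ := fun θ =>
    (∏ i, R i * Complex.exp (θ i * Complex.I) * Complex.I) * f (torusMap c R θ)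
  have hk : ∀ y ∈ Icc (0 : Fin n → ℝ) fun _ => 2 * π, AnalyticAt ℝ k (c, y) := by
    intro y _
    apply Finset.analyticAt_fun_prod
    intro i _
    apply AnalyticAt.fun_inv
    · apply AnalyticAt.sub
      · simp only [torusMap]
        refine analyticAt_const.add (analyticAt_const.mul (analyticAt_cexp_comp ?_))
        exact (analyticAt_ofReal (analyticAt_coord analyticAt_snd i)).mul analyticAt_const
      · exact analyticAt_coord analyticAt_fst i
    · exact torusMap_ne hR (fun i => by simpa using hR i) y i
  have hg : IntegrableOn g (Icc (0 : Fin n → ℝ) fun _ => 2 * π) volume := by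
    apply ContinuousOn.integrableOn_compact isCompact_Icc
    apply Continuous.continuousOn
    refine Continuous.mul (by fun_prop) ?_
    exact hf.continuousOn.comp_continuous (continuous_torusMap c R)
          fun θ => hRU _ fun i => (norm_torusMap_sub c hR θ i).le
  have h1 := analyticAt_setIntegral isCompact_Icc hk hg
  refine ((analyticAt_const (v := ((2 * π * Complex.I) ^ n)⁻¹)).mul h1).congr ?_
  filter_upwards [Metric.ball_mem_nhds c (half_pos hr)] with w hw
  have hw' : ∀ i, ‖w i - c i‖ < R i := by
    intro i
    rw [← dist_eq_norm]
    exact (dist_le_pi_dist w c i).trans_lt hw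
  have h2 := torusIntegral_cauchy hU hf hR hRU hw'
  rw [torusIntegral] at h2
  have h3 : (2 * (π : ℂ) * Complex.I) ^ n ≠ 0 :=
    pow_ne_zero _ (by simp [Real.pi_ne_zero, Complex.I_ne_zero])
  simp only [Pi.mul_apply]
  rw [inv_mul_eq_iff_eq_mul₀ h3, ← h2]
  congr 1; ext θ
  simp only [g, k, smul_eq_mul]
  ring

end Cauchy

/-! ### Densities on the torus and their realization by maps -/

section Densities

variable {n : ℕ}

/-- A function of the angles which descends to the torus. -/
def IsPeriodic {X : Type*} (H : (Fin n → ℝ) → X) : Prop :=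
  ∀ θ θ', cover θ = cover θ' → H θ = H θ'

/-- The unimodular function `z₁ ⋯ zₙ` in angular coordinates: up to the constant `iⁿ`, the density
of `Ω` on the torus with respect to `dθ`. -/
noncomputable def osc (θ : Fin n → ℝ) : ℂ := ∏ i, (Circle.exp (θ i) : ℂ)

/-- The Jacobian determinant `det (∂φ_i / ∂θ_k)`, that is, the density of `φ^* Ω` with respect to
`dθ`. -/
noncomputable def jac (φ : (Fin n → ℝ) → (Fin n → ℂ)) (θ : Fin n → ℝ) : ℂ :=
  Matrix.det (Matrix.of fun k => fderiv ℝ φ θ (Pi.single k 1))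

/-- The form `iⁿ H dθ` is `φ^* Ω` for an injective real analytic map `φ` of the torus, written in
angular coordinates. The constant `iⁿ` makes `osc` the density realized by the inclusion. -/
def Realizable (H : (Fin n → ℝ) → ℂ) : Prop :=
  ∃ φ : (Fin n → ℝ) → (Fin n → ℂ), AnalyticOnNhd ℝ φ univ ∧
    (∀ θ, jac φ θ = Complex.I ^ n * H θ) ∧ ∀ θ θ', φ θ = φ θ' ↔ cover θ = cover θ'

theorem cover_eq_iff {θ θ' : Fin n → ℝ} :
    cover θ = cover θ' ↔ ∃ m : Fin n → ℤ, θ = θ' + fun i => m i * (2 * Real.pi) := by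
  simp only [funext_iff, cover, Circle.exp_eq_exp, Pi.add_apply, Classical.skolem]

theorem cover_update {θ θ' : Fin n → ℝ} (h : cover θ = cover θ') (l : Fin n) {x y : ℝ}
    (hxy : Circle.exp x = Circle.exp y) :
    cover (Function.update θ l x) = cover (Function.update θ' l y) := by
  ext i
  by_cases hi : i = l
  · subst hi; simp [cover, hxy]
  · simpa [cover, hi] using congrArg (fun z : Circle => (z : ℂ)) (congrFun h i)

theorem isPeriodic_osc : IsPeriodic (osc (n := n)) := by
  intro θ θ' h
  exact Finset.prod_congr rfl fun i _ => congrArg (fun z : Circle => (z : ℂ)) (congrFun h i)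

theorem analyticAt_circleExp {E : Type*} [NormedAddCommGroup E] [NormedSpace ℝ E]
    {f : E → ℝ} {x : E} (hf : AnalyticAt ℝ f x) :
    AnalyticAt ℝ (fun x => (Circle.exp (f x) : ℂ)) x := by
  simp only [Circle.coe_exp]
  exact analyticAt_cexp_comp ((analyticAt_ofReal hf).mul analyticAt_const)

theorem hasDerivAt_circleExp (x : ℝ) : HasDerivAt (fun x : ℝ => (Circle.exp x : ℂ))
    (Circle.exp x * Complex.I) x := by
  simp only [Circle.coe_exp]
  simpa using ((Complex.ofRealCLM.hasDerivAt (x := x)).mul_const Complex.I).cexp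

theorem analyticOnNhd_osc : AnalyticOnNhd ℝ (osc (n := n)) univ := by
  intro θ _
  apply Finset.analyticAt_fun_prod
  intro i _
  exact analyticAt_circleExp (analyticAt_coord analyticAt_id i)

theorem norm_osc (θ : Fin n → ℝ) : ‖osc θ‖ = 1 := by simp [osc, norm_prod]

/-- `osc` is `e^{iθ_l}` times a function independent of `θ_l`. -/
theorem osc_update (θ : Fin n → ℝ) (l : Fin n) (x : ℝ) :
    osc (Function.update θ l x) = Circle.exp x * osc (Function.update θ l 0) := by
  have h : ∀ y, osc (Function.update θ l y) =
      Circle.exp y * ∏ i ∈ Finset.univ.erase l, (Circle.exp (θ i) : ℂ) := by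
    intro y
    rw [osc, ← Finset.mul_prod_erase _ _ (Finset.mem_univ l)]
    congr 1
    · simp
    · exact Finset.prod_congr rfl fun i hi => by simp [Finset.ne_of_mem_erase hi]
  rw [h, h]; simp

/-- A real-linear map into `ℂⁿ` pulls the complex determinant back to a complex multiple of the real
one. -/
theorem det_of_map (L : (Fin n → ℝ) →L[ℝ] (Fin n → ℂ)) (v : Fin n → Fin n → ℝ) :
    Matrix.det (Matrix.of fun i => L (v i)) =
      ((Matrix.det (Matrix.of v) : ℝ) : ℂ) *
        Matrix.det (Matrix.of fun k => L (Pi.single k 1)) := by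
  have h1 : ((Matrix.det (Matrix.of v) : ℝ) : ℂ) =
      Matrix.det ((Matrix.of v).map Complex.ofReal) := by
    have := RingHom.map_det Complex.ofRealHom (Matrix.of v)
    exact this
  rw [h1, ← Matrix.det_mul]
  congr 1
  ext i j
  have h2 := LinearMap.pi_apply_eq_sum_univ (L : (Fin n → ℝ) →ₗ[ℝ] (Fin n → ℂ)) (v i)
  have h3 : ∀ k : Fin n, (fun j => if k = j then (1 : ℝ) else 0) = Pi.single k 1 := by
    intro k; ext j; simp [Pi.single_apply, eq_comm]
  simp only [h3] at h2
  change L (v i) = ∑ k : Fin n, v i k • L (Pi.single k (1 : ℝ)) at h2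
  simp only [Matrix.of_apply, h2, Matrix.mul_apply, Matrix.map_apply]
  simp [Finset.sum_apply]

theorem jac_comp {φ : (Fin n → ℝ) → (Fin n → ℂ)} {S : (Fin n → ℝ) → (Fin n → ℝ)}
    {θ : Fin n → ℝ} (hφ : DifferentiableAt ℝ φ (S θ)) (hS : DifferentiableAt ℝ S θ) :
    jac (fun θ => φ (S θ)) θ =
      ((Matrix.det (Matrix.of fun k => fderiv ℝ S θ (Pi.single k 1)) : ℝ) : ℂ) *
        jac φ (S θ) := by
  rw [jac, jac, ← det_of_map]
  congr 2
  ext1 k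
  have := fderiv_comp θ hφ hS
  simp only [Function.comp_def] at this
  rw [this]; rfl

end Densities

/-! ### Changing one angle -/

section Shear

variable {n : ℕ} {s : (Fin n → ℝ) → ℝ} {j : Fin n}

theorem hasFDerivAt_shear {θ : Fin n → ℝ} (hs : DifferentiableAt ℝ s θ) :
    HasFDerivAt (fun θ => θ - s θ • (Pi.single j 1 : Fin n → ℝ))
      (ContinuousLinearMap.id ℝ _ - (fderiv ℝ s θ).smulRight (Pi.single j 1)) θ :=
  (hasFDerivAt_id θ).sub (hs.hasFDerivAt.smul_const _)

theorem det_shear (L : (Fin n → ℝ) →L[ℝ] ℝ) :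
    Matrix.det (Matrix.of fun k : Fin n => (ContinuousLinearMap.id ℝ (Fin n → ℝ) -
      L.smulRight (Pi.single j 1 : Fin n → ℝ)) (Pi.single k 1)) = 1 - L (Pi.single j 1) := by
  have h := Matrix.det_one_add_replicateCol_mul_replicateRow (ι := Unit)
    (fun k : Fin n => -L (Pi.single k 1)) (Pi.single j 1)
  rw [show 1 - L (Pi.single j 1) = 1 + (Pi.single j 1 : Fin n → ℝ) ⬝ᵥ fun k => -L (Pi.single k 1) by
    simp; ring, ← h]
  congr 1
  ext k i
  simp [Matrix.mul_apply, Matrix.one_apply, Pi.single_apply, eq_comm, sub_eq_add_neg]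
  split_ifs <;> simp

/-- Changing the angle `θ_j` by a function whose partial derivative in `θ_j` is at most `1 / 2` is a
bijection of `ℝⁿ`. -/
theorem bijective_shear (hs : Differentiable ℝ s)
    (hsmall : ∀ θ, |fderiv ℝ s θ (Pi.single j 1)| ≤ 1 / 2) :
    Function.Bijective (fun θ => θ - s θ • (Pi.single j 1 : Fin n → ℝ)) := by
  have hder : ∀ θ x, HasDerivAt (fun x : ℝ => s (θ + x • Pi.single j 1))
      (fderiv ℝ s (θ + x • Pi.single j 1) (Pi.single j 1)) x := by
    intro θ x
    have h1 : HasDerivAt (fun x : ℝ => θ + x • (Pi.single j 1 : Fin n → ℝ)) (Pi.single j 1) x := by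
      simpa using ((hasDerivAt_id x).smul_const (Pi.single j 1 : Fin n → ℝ)).const_add θ
    exact (hs _).hasFDerivAt.comp_hasDerivAt x h1
  -- on each line in the direction `j`, the map has derivative at least `1 / 2`
  have hmono : ∀ θ, Monotone fun x : ℝ => x / 2 - s (θ + x • Pi.single j 1) := by
    intro θ
    have h1 : ∀ x, HasDerivAt (fun x : ℝ => x / 2 - s (θ + x • Pi.single j 1))
        (1 / 2 - fderiv ℝ s (θ + x • Pi.single j 1) (Pi.single j 1)) x := fun x =>
      ((hasDerivAt_id x).div_const 2).sub (hder θ x)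
    refine monotone_of_deriv_nonneg (fun x => (h1 x).differentiableAt) fun x => ?_
    rw [(h1 x).deriv]
    linarith [(abs_le.1 (hsmall (θ + x • Pi.single j 1))).2]
  have hcont : ∀ θ, Continuous fun x : ℝ => x - s (θ + x • Pi.single j 1) := fun θ =>
    continuous_id.sub (hs.continuous.comp (by fun_prop))
  refine ⟨fun θ θ' h => ?_, fun α => ?_⟩
  · obtain ⟨x, hx⟩ : ∃ x : ℝ, θ' = θ + x • Pi.single j 1 := by
      refine ⟨s θ' - s θ, ?_⟩
      simp only at h
      rw [sub_smul, ← sub_eq_zero] at *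
      rw [← neg_eq_zero, ← h]; abel
    subst hx
    have h1 : x = s (θ + x • Pi.single j 1) - s θ := by
      have := congrFun h j
      simp at this
      linarith
    have h2 : x = 0 := by
      rcases le_total 0 x with h0 | h0
      · have := hmono θ h0
        simp only [zero_smul, add_zero] at this
        linarith
      · have := hmono θ h0
        simp only [zero_smul, add_zero] at this
        linarith
    simp [h2]
  · have hsurj : Function.Surjective fun x : ℝ => x - s (α + x • Pi.single j 1) := by
      refine (hcont α).surjective ?_ ?_
      · refine tendsto_atTop_mono' (f₁ := fun x : ℝ => x / 2 - s α) _ ?_ ?_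
        · filter_upwards [eventually_ge_atTop 0] with x hx
          have := hmono α hx
          simp only [zero_smul, add_zero] at this
          linarith
        · exact tendsto_atTop_add_const_right _ _ (tendsto_id.atTop_div_const (by norm_num))
      · refine tendsto_atBot_mono' (f₁ := fun x : ℝ => x / 2 - s α) _ ?_ ?_
        · filter_upwards [eventually_le_atBot 0] with x hx
          have := hmono α hx
          simp only [zero_smul, add_zero] at this
          linarith
        · exact tendsto_atBot_add_const_right _ _ (tendsto_id.atBot_div_const (by norm_num))
    obtain ⟨x, hx⟩ := hsurj 0
    refine ⟨α + x • Pi.single j 1, ?_⟩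
    have : s (α + x • Pi.single j 1) = x := by simp only at hx; linarith
    simp only [this, add_sub_cancel_right]

theorem cover_shear_eq_iff (hs : Differentiable ℝ s) (hper : IsPeriodic s)
    (hsmall : ∀ θ, |fderiv ℝ s θ (Pi.single j 1)| ≤ 1 / 2) {θ θ' : Fin n → ℝ} :
    cover (θ - s θ • (Pi.single j 1 : Fin n → ℝ)) = cover (θ' - s θ' • Pi.single j 1) ↔
      cover θ = cover θ' := by
  constructor
  · intro h
    obtain ⟨m, hm⟩ := cover_eq_iff.1 h
    have h1 : cover (θ' + fun i => m i * (2 * Real.pi)) = cover θ' := cover_eq_iff.2 ⟨m, rfl⟩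
    have h2 : θ = θ' + fun i => m i * (2 * Real.pi) := by
      apply (bijective_shear hs hsmall).1
      simp only
      rw [hm, hper _ _ h1]; abel
    rw [h2, h1]
  · intro h
    rw [hper _ _ h]
    obtain ⟨m, hm⟩ := cover_eq_iff.1 h
    refine cover_eq_iff.2 ⟨m, ?_⟩
    rw [hm]; abel

/-- Realizability is transported along the diffeomorphism `θ ↦ θ - s(θ) e_j` of the torus, under
which a density `H` becomes `H' = (H ∘ S) det S'`. -/
theorem Realizable.of_shear (hs : AnalyticOnNhd ℝ s univ) (hper : IsPeriodic s)
    (hsmall : ∀ θ, |fderiv ℝ s θ (Pi.single j 1)| ≤ 1 / 2) {H H' : (Fin n → ℝ) → ℂ}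
    (hH' : ∀ θ, H' θ = H (θ - s θ • Pi.single j 1) *
      ((1 - fderiv ℝ s θ (Pi.single j 1) : ℝ) : ℂ)) (h : Realizable H') : Realizable H := by
  obtain ⟨φ, hφa, hφj, hφi⟩ := h
  have hd : Differentiable ℝ s := fun θ => (hs θ trivial).differentiableAt
  have hbij := bijective_shear hd hsmall
  have hpos : ∀ θ, 1 - fderiv ℝ s θ (Pi.single j 1) ≠ 0 := fun θ => by
    have := (abs_le.1 (hsmall θ)).2
    intro h; linarith
  let S : (Fin n → ℝ) → (Fin n → ℝ) := fun θ => θ - s θ • (Pi.single j 1 : Fin n → ℝ)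
  let T : (Fin n → ℝ) → (Fin n → ℝ) := Function.surjInv hbij.2
  have hST : ∀ α, S (T α) = α := Function.surjInv_eq hbij.2
  have hTS : ∀ θ, T (S θ) = θ := fun θ => hbij.1 (hST _)
  have hSa : AnalyticOnNhd ℝ S univ := fun θ _ =>
    analyticAt_id.sub ((hs θ trivial).smul analyticAt_const)
  have hSd : ∀ θ, HasFDerivAt S _ θ := fun θ => hasFDerivAt_shear (j := j) (hd θ)
  have hTa : ∀ α, AnalyticAt ℝ T α := by
    intro α
    refine analyticAt_of_comp_injOn isOpen_univ hSa hbij.1.injOn (fun θ _ => ?_)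
      (fun _ => trivial) (by simp only [hST]; exact analyticAt_id)
    rw [(hSd θ).fderiv, injective_iff_map_eq_zero]
    intro v hv
    have hv1 : v = fderiv ℝ s θ v • Pi.single j 1 := sub_eq_zero.1 hv
    have hv2 := congrArg (fderiv ℝ s θ) hv1
    rw [map_smul, smul_eq_mul] at hv2
    have hv3 : fderiv ℝ s θ v * (1 - fderiv ℝ s θ (Pi.single j 1)) = 0 := by linarith
    rw [hv1, (mul_eq_zero.1 hv3).resolve_right (hpos θ), zero_smul]
  refine ⟨fun α => φ (T α), fun α _ => (hφa _ trivial).comp (hTa α), fun α => ?_, fun α α' => ?_⟩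
  · obtain ⟨θ, rfl⟩ := hbij.2 α
    have hc := jac_comp (φ := fun α => φ (T α)) (S := S) (θ := θ)
      (((hφa _ trivial).comp (hTa (S θ))).differentiableAt) (hSd θ).differentiableAt
    simp only [hTS] at hc
    rw [(hSd θ).fderiv, det_shear, hφj, hH'] at hc
    have hne : ((1 - fderiv ℝ s θ (Pi.single j 1) : ℝ) : ℂ) ≠ 0 := by exact_mod_cast hpos θ
    apply mul_left_cancel₀ hne
    rw [← hc]
    ring
  · rw [hφi, ← cover_shear_eq_iff (j := j) hd hper hsmall]
    change cover (S (T α)) = cover (S (T α')) ↔ _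
    rw [hST, hST]

end Shear

/-! ### Densities with vanishing means along one angle -/

section Primitive

variable {n : ℕ}

/-- The mean of `H` over the angle `θ_l`, as a function of `θ` independent of `θ_l`. -/
noncomputable def mean (l : Fin n) (H : (Fin n → ℝ) → ℂ) (θ : Fin n → ℝ) : ℂ :=
  (2 * Real.pi : ℂ)⁻¹ * ∫ x in (0 : ℝ)..2 * Real.pi, H (Function.update θ l x)

/-- The primitive of `H` in the direction `θ_l` which vanishes for `θ_l = 0`. -/
noncomputable def primitive (l : Fin n) (H : (Fin n → ℝ) → ℂ) (θ : Fin n → ℝ) : ℂ :=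
  ∫ x in (0 : ℝ)..θ l, H (Function.update θ l x)

theorem analyticAt_update {E : Type*} [NormedAddCommGroup E] [NormedSpace ℝ E]
    {f : E → Fin n → ℝ} {g : E → ℝ} {x : E} (hf : AnalyticAt ℝ f x) (hg : AnalyticAt ℝ g x)
    (l : Fin n) : AnalyticAt ℝ (fun x => Function.update (f x) l (g x)) x := by
  have h : ∀ x, Function.update (f x) l (g x) =
      f x + (g x - f x l) • (Pi.single l 1 : Fin n → ℝ) := by
    intro x
    ext i
    by_cases hi : i = l
    · subst hi; simp
    · simp [hi]
  simp only [h]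
  exact hf.add ((hg.sub (analyticAt_coord hf l)).smul analyticAt_const)

theorem continuous_update_line {X : Type*} [TopologicalSpace X] {H : (Fin n → ℝ) → X}
    (hH : Continuous H) (θ : Fin n → ℝ) (l : Fin n) :
    Continuous fun x : ℝ => H (Function.update θ l x) :=
  hH.comp (continuous_const.update l continuous_id)

theorem primitive_eq (l : Fin n) (H : (Fin n → ℝ) → ℂ) (θ : Fin n → ℝ) :
    primitive l H θ = ∫ u in (0 : ℝ)..1, θ l * H (Function.update θ l (θ l * u)) := by
  have := intervalIntegral.smul_integral_comp_mul_left (a := 0) (b := 1)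
    (fun x => H (Function.update θ l x)) (θ l)
  rw [primitive, intervalIntegral.integral_const_mul]
  simpa using this.symm

theorem analyticOnNhd_primitive {H : (Fin n → ℝ) → ℂ} (hH : AnalyticOnNhd ℝ H univ) (l : Fin n) :
    AnalyticOnNhd ℝ (primitive l H) univ := by
  rw [show primitive l H = _ from funext (primitive_eq l H)]
  refine analyticOnNhd_intervalIntegral (k := fun q : (Fin n → ℝ) × ℝ =>
    (q.1 l : ℂ) * H (Function.update q.1 l (q.1 l * q.2))) (fun q _ => ?_) zero_le_one
  have h1 : AnalyticAt ℝ (fun q : (Fin n → ℝ) × ℝ => q.1 l) q := analyticAt_coord analyticAt_fst l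
  exact (analyticAt_ofReal h1).mul ((hH _ trivial).comp
    (analyticAt_update analyticAt_fst (h1.mul analyticAt_snd) l))

theorem analyticOnNhd_mean {H : (Fin n → ℝ) → ℂ} (hH : AnalyticOnNhd ℝ H univ) (l : Fin n) :
    AnalyticOnNhd ℝ (mean l H) univ := by
  have := analyticOnNhd_intervalIntegral (k := fun q : (Fin n → ℝ) × ℝ =>
    H (Function.update q.1 l q.2)) (fun q _ => (hH _ trivial).comp
      (analyticAt_update analyticAt_fst analyticAt_snd l)) Real.two_pi_pos.le
  exact fun θ hθ => analyticAt_const.mul (this θ hθ)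

theorem primitive_update (l : Fin n) (H : (Fin n → ℝ) → ℂ) (θ : Fin n → ℝ) (x : ℝ) :
    primitive l H (Function.update θ l x) = ∫ ξ in (0 : ℝ)..x, H (Function.update θ l ξ) := by
  simp [primitive]

theorem hasDerivAt_primitive {H : (Fin n → ℝ) → ℂ} (hH : Continuous H) (l : Fin n)
    (θ : Fin n → ℝ) (x : ℝ) :
    HasDerivAt (fun x => primitive l H (Function.update θ l x)) (H (Function.update θ l x)) x := by
  simp only [primitive_update]
  exact intervalIntegral.integral_hasDerivAt_right
    ((continuous_update_line hH θ l).intervalIntegrable _ _)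
    ((continuous_update_line hH θ l).stronglyMeasurableAtFilter _ _)
    (continuous_update_line hH θ l).continuousAt

theorem periodic_update {X : Type*} {H : (Fin n → ℝ) → X} (hH : IsPeriodic H) (θ : Fin n → ℝ)
    (l : Fin n) : Function.Periodic (fun x => H (Function.update θ l x)) (2 * Real.pi) :=
  fun _ => hH _ _ (cover_update rfl l (by simp))

theorem isPeriodic_mean {H : (Fin n → ℝ) → ℂ} (hH : IsPeriodic H) (l : Fin n) :
    IsPeriodic (mean l H) := by
  intro θ θ' h
  simp only [mean]
  congr 1
  exact intervalIntegral.integral_congr fun x _ => hH _ _ (cover_update h l rfl)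

/-- Going around once in the angle `θ_l` increases the primitive by `2π` times the mean. -/
theorem primitive_of_cover_eq {H : (Fin n → ℝ) → ℂ} (hH : Continuous H) (hper : IsPeriodic H)
    (l : Fin n) {θ θ' : Fin n → ℝ} (h : cover θ = cover θ') :
    primitive l H θ - θ l * mean l H θ = primitive l H θ' - θ' l * mean l H θ' := by
  obtain ⟨m, hm⟩ := Circle.exp_eq_exp.1 (congrFun h l)
  have hq : ∀ x, H (Function.update θ l x) = H (Function.update θ' l x) := fun x =>
    hper _ _ (cover_update h l rfl)
  have hp := periodic_update hper θ' l
  have hc := continuous_update_line hH θ' l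
  rw [isPeriodic_mean hper l _ _ h, primitive, primitive, hm]
  simp only [hq]
  rw [← intervalIntegral.integral_add_adjacent_intervals (hc.intervalIntegrable 0 (θ' l))
    (hc.intervalIntegrable _ _)]
  have h1 := hp.intervalIntegral_add_zsmul_eq m (θ' l) (fun a b => hc.intervalIntegrable _ _)
  rw [zsmul_eq_mul, hp.intervalIntegral_add_eq (θ' l) 0, zero_add] at h1
  rw [h1, mean]
  have hpi : (Real.pi : ℂ) ≠ 0 := by exact_mod_cast Real.pi_ne_zero
  push_cast
  rw [zsmul_eq_mul]
  field_simp
  ring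

/-- A chord of the unit circle is at least `2 / π` times as long as its arc. -/
theorem two_div_pi_mul_le_norm_exp_sub {x y : ℝ} (h : |y - x| ≤ Real.pi) :
    2 / Real.pi * |y - x| ≤ ‖(Circle.exp y : ℂ) - Circle.exp x‖ := by
  have h1 : (Circle.exp y : ℂ) - Circle.exp x =
      Circle.exp x * (Complex.exp (Complex.I * ((y - x : ℝ) : ℂ)) - 1) := by
    simp only [Circle.coe_exp, mul_sub, ← Complex.exp_add]
    push_cast; ring_nf
  rw [h1, norm_mul, Circle.norm_coe, one_mul, Complex.norm_exp_I_mul_ofReal_sub_one, norm_mul]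
  have h2 : |(y - x) / 2| ≤ Real.pi / 2 := by rw [abs_div, abs_two]; linarith
  have h3 := Real.mul_abs_le_abs_sin h2
  rw [abs_div, abs_two] at h3
  simp only [Real.norm_eq_abs, abs_two]
  linarith

theorem intervalIntegral_circleExp (x y : ℝ) :
    ∫ ξ in x..y, (Circle.exp ξ : ℂ) = ((Circle.exp y : ℂ) - Circle.exp x) / Complex.I := by
  have := integral_exp_mul_complex (a := x) (b := y) Complex.I_ne_zero
  simp only [Circle.coe_exp]
  simpa [mul_comm] using this

/-- If `H` is close to the unimodular function `osc` then the primitive in the direction `θ_l` is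
injective modulo periods. -/
theorem exp_eq_of_primitive_eq {H : (Fin n → ℝ) → ℂ} (hH : Continuous H) (hper : IsPeriodic H)
    (hclose : ∀ θ, ‖H θ - osc θ‖ ≤ 1 / 2) (l : Fin n) (hmean : ∀ θ, mean l H θ = 0)
    {θ : Fin n → ℝ} {x y : ℝ}
    (h : primitive l H (Function.update θ l x) = primitive l H (Function.update θ l y)) :
    Circle.exp x = Circle.exp y := by
  -- `y` may be moved to distance at most `π` from `x`
  obtain ⟨z, hz, hzx⟩ : ∃ z, Circle.exp z = Circle.exp y ∧ |z - x| ≤ Real.pi := by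
    refine ⟨y - round ((y - x) / (2 * Real.pi)) * (2 * Real.pi), ?_, ?_⟩
    · rw [Circle.exp_sub, Circle.exp_int_mul_two_pi, div_one]
    · have h1 := abs_sub_round ((y - x) / (2 * Real.pi))
      have h2 : y - round ((y - x) / (2 * Real.pi)) * (2 * Real.pi) - x =
          ((y - x) / (2 * Real.pi) - round ((y - x) / (2 * Real.pi))) * (2 * Real.pi) := by
        field_simp; ring
      rw [h2, abs_mul, abs_of_pos Real.two_pi_pos]
      nlinarith [Real.pi_pos]
  have h1 := primitive_of_cover_eq hH hper l (cover_update (rfl : cover θ = cover θ) l hz)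
  simp only [hmean, mul_zero, sub_zero] at h1
  rw [← h1, primitive_update, primitive_update] at h
  have hc := continuous_update_line hH θ l
  have h0 : ∫ ξ in x..z, H (Function.update θ l ξ) = 0 := by
    rw [← intervalIntegral.integral_interval_sub_left (hc.intervalIntegrable 0 z)
      (hc.intervalIntegrable 0 x), h, sub_self]
  have hce : Continuous fun ξ : ℝ => (Circle.exp ξ : ℂ) * osc (Function.update θ l 0) := by
    fun_prop
  have h2 : ‖∫ ξ in x..z, (H (Function.update θ l ξ) - osc (Function.update θ l ξ))‖ ≤
      1 / 2 * |z - x| :=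
    intervalIntegral.norm_integral_le_of_norm_le_const fun ξ _ => hclose _
  have h3 : ∫ ξ in x..z, (H (Function.update θ l ξ) - osc (Function.update θ l ξ)) =
      -(((Circle.exp z : ℂ) - Circle.exp x) / Complex.I * osc (Function.update θ l 0)) := by
    have h4 : ∀ ξ, H (Function.update θ l ξ) - osc (Function.update θ l ξ) =
        H (Function.update θ l ξ) - Circle.exp ξ * osc (Function.update θ l 0) := fun ξ => by
      rw [osc_update θ l ξ]
    simp only [h4]
    rw [intervalIntegral.integral_sub (hc.intervalIntegrable _ _)
      (hce.intervalIntegrable _ _), h0,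
      intervalIntegral.integral_mul_const, intervalIntegral_circleExp, zero_sub]
  rw [h3, norm_neg, norm_mul, norm_osc, norm_div, Complex.norm_I, div_one, mul_one] at h2
  have h4 := two_div_pi_mul_le_norm_exp_sub hzx
  have h5 : (1 / 2 : ℝ) < 2 / Real.pi := by
    rw [lt_div_iff₀ Real.pi_pos]; linarith [Real.pi_lt_four]
  have h6 : |z - x| = 0 := by
    by_contra hne
    have : 0 < |z - x| := lt_of_le_of_ne (abs_nonneg _) (Ne.symm hne)
    nlinarith
  rw [← hz, sub_eq_zero.1 (abs_eq_zero.1 h6)]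

/-- A density close to `osc` whose means over the angle `θ_l` all vanish is realized by
`φ_k = e^{iθ_k}` for `k ≠ l` and a multiple of a primitive of it in the direction `θ_l`. -/
theorem realizable_of_mean_eq_zero {H : (Fin n → ℝ) → ℂ} (hH : AnalyticOnNhd ℝ H univ)
    (hper : IsPeriodic H) (hclose : ∀ θ, ‖H θ - osc θ‖ ≤ 1 / 2) {l : Fin n} (hl : ∀ i, l ≤ i)
    (hmean : ∀ θ, mean l H θ = 0) : Realizable H := by
  have hHc : Continuous H := hH.continuous
  let c : (Fin n → ℝ) → ℂ := fun θ => ∏ k ∈ Finset.univ.erase l, (Circle.exp (-θ k) : ℂ)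
  let Q : (Fin n → ℝ) → ℂ := fun θ => Complex.I * (c θ * primitive l H θ)
  let φ : (Fin n → ℝ) → (Fin n → ℂ) := fun θ i => if i = l then Q θ else Circle.exp (θ i)
  have hcupd : ∀ θ x, c (Function.update θ l x) = c θ := fun θ x =>
    Finset.prod_congr rfl fun k hk => by simp [Finset.ne_of_mem_erase hk]
  have hQa : AnalyticOnNhd ℝ Q univ := fun θ _ => analyticAt_const.mul
    ((Finset.analyticAt_fun_prod _ fun k _ =>
      analyticAt_circleExp (analyticAt_coord analyticAt_id k).neg).mul
      (analyticOnNhd_primitive hH l θ trivial))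
  have hea : ∀ i θ, AnalyticAt ℝ (fun θ : Fin n → ℝ => (Circle.exp (θ i) : ℂ)) θ := fun i θ =>
    analyticAt_circleExp (analyticAt_coord analyticAt_id i)
  have hφi : ∀ i θ, AnalyticAt ℝ (fun θ => φ θ i) θ := by
    intro i θ
    by_cases hi : i = l
    · simp only [φ, hi, if_true]; exact hQa θ trivial
    · simp only [φ, hi, if_false]; exact hea i θ
  have hφa : AnalyticOnNhd ℝ φ univ := fun θ _ => AnalyticAt.pi fun i => hφi i θ
  -- partial derivatives are derivatives along lines
  have hpart : ∀ (f : (Fin n → ℝ) → ℂ) (f' : ℂ) (θ) (k : Fin n), DifferentiableAt ℝ f θ →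
      HasDerivAt (fun x => f (Function.update θ k x)) f' (θ k) →
      fderiv ℝ f θ (Pi.single k 1) = f' := by
    intro f f' θ k hf hd
    have h1 := hasDerivAt_update θ k (θ k)
    have h2 : HasFDerivAt f (fderiv ℝ f θ) (Function.update θ k (θ k)) := by
      simpa using hf.hasFDerivAt
    exact (h2.comp_hasDerivAt _ h1).unique hd
  have hcomp : ∀ θ (v : Fin n → ℝ) i, fderiv ℝ φ θ v i = fderiv ℝ (fun θ => φ θ i) θ v := by
    intro θ v i
    have := (hasFDerivAt_pi'.1 (hφa θ trivial).differentiableAt.hasFDerivAt i).fderiv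
    rw [this]; rfl
  have hentry : ∀ θ (k i : Fin n), i ≠ l → fderiv ℝ φ θ (Pi.single k 1) i =
      if k = i then Circle.exp (θ i) * Complex.I else 0 := by
    intro θ k i hi
    rw [hcomp]
    apply hpart _ _ _ _ (hφi i θ).differentiableAt
    by_cases hk : k = i
    · subst hk; simpa [φ, hi] using hasDerivAt_circleExp (θ k)
    · simpa [φ, hi, hk, Function.update_of_ne (Ne.symm hk)] using hasDerivAt_const _ _
  have hlast : ∀ θ, fderiv ℝ φ θ (Pi.single l 1) l = Complex.I * (c θ * H θ) := by
    intro θ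
    rw [hcomp]
    apply hpart _ _ _ _ (hφi l θ).differentiableAt
    simp only [φ, if_true, Q, hcupd]
    have := hasDerivAt_primitive hHc l θ (θ l)
    rw [Function.update_eq_self] at this
    exact (this.const_mul _).const_mul _
  have hcne : ∀ θ, c θ ≠ 0 := fun θ => Finset.prod_ne_zero_iff.2 fun k _ => Circle.coe_ne_zero _
  refine ⟨φ, hφa, fun θ => ?_, fun θ θ' => ⟨fun h => ?_, fun h => ?_⟩⟩
  · rw [jac, Matrix.det_of_isLowerTriangular]
    · rw [← Finset.mul_prod_erase _ _ (Finset.mem_univ l), Matrix.of_apply, hlast]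
      have h1 : ∏ i ∈ Finset.univ.erase l, (Matrix.of fun k => fderiv ℝ φ θ (Pi.single k 1)) i i =
          ∏ i ∈ Finset.univ.erase l, ((Circle.exp (θ i) : ℂ) * Complex.I) :=
        Finset.prod_congr rfl fun i hi => by
          rw [Matrix.of_apply, hentry θ i i (Finset.ne_of_mem_erase hi), if_pos rfl]
      have h2 : c θ * ∏ i ∈ Finset.univ.erase l, (Circle.exp (θ i) : ℂ) = 1 := by
        rw [← Finset.prod_mul_distrib]
        exact Finset.prod_eq_one fun k _ => by simp [Circle.exp_neg]
      rw [h1, Finset.prod_mul_distrib, Finset.prod_const, Finset.card_erase_of_mem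
        (Finset.mem_univ l), Finset.card_univ, Fintype.card_fin]
      have h3 : Complex.I ^ n = Complex.I ^ (n - 1) * Complex.I := by
        rw [← pow_succ, Nat.sub_add_cancel l.pos]
      rw [h3]
      linear_combination (Complex.I ^ (n - 1) * Complex.I * H θ) * h2
    · intro k i hki
      have hki' : k < i := hki
      rw [Matrix.of_apply, hentry θ k i ((hl k).trans_lt hki').ne', if_neg hki'.ne]
  · have h1 : ∀ i, i ≠ l → Circle.exp (θ i) = Circle.exp (θ' i) := by
      intro i hi
      have := congrFun h i
      simp only [φ, hi, if_false] at this
      exact Circle.ext this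
    have h2 : cover θ' = cover (Function.update θ l (θ' l)) := by
      ext i
      by_cases hi : i = l
      · subst hi; simp [cover]
      · simp [cover, hi, h1 i hi]
    have h3 : c θ' = c θ :=
      Finset.prod_congr rfl fun k hk => by
        simp [Circle.exp_neg, h1 k (Finset.ne_of_mem_erase hk)]
    have h4 : primitive l H θ = primitive l H θ' := by
      have := congrFun h l
      simp only [φ, if_true, Q, h3] at this
      exact mul_left_cancel₀ (hcne θ) (mul_left_cancel₀ Complex.I_ne_zero this)
    have h5 := primitive_of_cover_eq hHc hper l h2
    simp only [hmean, mul_zero, sub_zero] at h5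
    have h6 : Circle.exp (θ l) = Circle.exp (θ' l) := by
      apply exp_eq_of_primitive_eq hHc hper hclose l hmean (θ := θ)
      rw [← h5, Function.update_eq_self, h4]
    ext1 i
    by_cases hi : i = l
    · subst hi; exact h6
    · exact h1 i hi
  · have h1 : ∀ i, Circle.exp (θ i) = Circle.exp (θ' i) := fun i => congrFun h i
    have h5 := primitive_of_cover_eq hHc hper l h
    simp only [hmean, mul_zero, sub_zero] at h5
    ext i
    by_cases hi : i = l
    · have h3 : c θ = c θ' := Finset.prod_congr rfl fun k hk => by simp [Circle.exp_neg, h1 k]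
      simp only [φ, hi, if_true, Q, h3, h5]
    · simp only [φ, hi, if_false, h1]

end Primitive

/-! ### Means and primitives along one angle -/

section Mean

variable {n : ℕ}

theorem analyticAt_fderiv_apply {E : Type*} [NormedAddCommGroup E] [NormedSpace ℝ E]
    [CompleteSpace E] {f : (Fin n → ℝ) → E} (hf : AnalyticOnNhd ℝ f univ) (v θ : Fin n → ℝ) :
    AnalyticAt ℝ (fun θ => fderiv ℝ f θ v) θ :=
  ((ContinuousLinearMap.apply ℝ E v).analyticAt _).comp (hf.fderiv θ trivial)

theorem IsPeriodic.fderiv {E : Type*} [NormedAddCommGroup E] [NormedSpace ℝ E]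
    {f : (Fin n → ℝ) → E} (hf : IsPeriodic f) : IsPeriodic (fderiv ℝ f) := by
  intro θ θ' h
  obtain ⟨m, hm⟩ := cover_eq_iff.1 h
  have h1 : (fun θ => f (θ + fun i => m i * (2 * Real.pi))) = f :=
    funext fun θ => hf _ _ (cover_eq_iff.2 ⟨m, rfl⟩)
  rw [hm, ← fderiv_comp_add_right, h1]

theorem osc_add_single (θ : Fin n → ℝ) (j : Fin n) (x : ℝ) :
    osc (θ + x • Pi.single j 1) = Circle.exp x * osc θ := by
  have h : θ + x • Pi.single j 1 = Function.update θ j (θ j + x) := by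
    ext i
    by_cases hi : i = j
    · subst hi; simp
    · simp [hi]
  have h2 := osc_update θ j (θ j)
  rw [Function.update_eq_self] at h2
  rw [h, osc_update, h2, Circle.exp_add, Circle.coe_mul]
  ring

theorem norm_osc_add_single_sub_le (θ : Fin n → ℝ) (j : Fin n) (x : ℝ) :
    ‖osc (θ + x • Pi.single j 1) - osc θ‖ ≤ |x| := by
  have h : osc (θ + x • Pi.single j 1) - osc θ =
      (Complex.exp (Complex.I * x) - 1) * osc θ := by
    rw [osc_add_single, Circle.coe_exp, mul_comm Complex.I]; ring
  rw [h, norm_mul, norm_osc, mul_one]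
  exact Real.norm_exp_I_mul_ofReal_sub_one_le

theorem norm_mean_le {l : Fin n} {H : (Fin n → ℝ) → ℂ} {θ : Fin n → ℝ} {C : ℝ}
    (h : ∀ x, ‖H (Function.update θ l x)‖ ≤ C) : ‖mean l H θ‖ ≤ C := by
  have h1 : ‖∫ x in (0 : ℝ)..2 * Real.pi, H (Function.update θ l x)‖ ≤
      C * |2 * Real.pi - 0| :=
    intervalIntegral.norm_integral_le_of_norm_le_const fun ξ _ => h _
  rw [sub_zero, abs_of_pos Real.two_pi_pos] at h1
  have h2 : ‖(2 * Real.pi : ℂ)⁻¹‖ = (2 * Real.pi)⁻¹ := by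
    rw [norm_inv, norm_mul, Complex.norm_real, Real.norm_of_nonneg Real.pi_pos.le]; simp
  rw [mean, norm_mul, h2, inv_mul_le_iff₀ Real.two_pi_pos]
  linarith

theorem mean_sub {l : Fin n} {G H : (Fin n → ℝ) → ℂ} (hG : Continuous G) (hH : Continuous H)
    (θ : Fin n → ℝ) : mean l (fun θ => G θ - H θ) θ = mean l G θ - mean l H θ := by
  simp only [mean]
  rw [intervalIntegral.integral_sub ((continuous_update_line hG θ l).intervalIntegrable _ _)
    ((continuous_update_line hH θ l).intervalIntegrable _ _), mul_sub]

theorem mean_congr {l : Fin n} {G H : (Fin n → ℝ) → ℂ} {θ θ' : Fin n → ℝ}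
    (h : ∀ x, G (Function.update θ l x) = H (Function.update θ' l x)) :
    mean l G θ = mean l H θ' := by
  simp only [mean, h]

theorem mean_update (l : Fin n) (H : (Fin n → ℝ) → ℂ) (θ : Fin n → ℝ) (x : ℝ) :
    mean l H (Function.update θ l x) = mean l H θ :=
  mean_congr fun y => by simp

theorem mean_add_single (l : Fin n) (H : (Fin n → ℝ) → ℂ) (θ : Fin n → ℝ) (x : ℝ) :
    mean l H (θ + x • Pi.single l 1) = mean l H θ :=
  mean_congr fun y => by
    congr 1; ext i
    by_cases hi : i = l
    · subst hi; simp
    · simp [hi]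

theorem update_add_single {l j : Fin n} (hjl : j ≠ l) (θ : Fin n → ℝ) (x y : ℝ) :
    Function.update (θ + x • (Pi.single j 1 : Fin n → ℝ)) l y =
      Function.update θ l y + x • Pi.single j 1 := by
  ext i
  by_cases hi : i = l
  · subst hi; simp [Ne.symm hjl]
  · simp [hi]

theorem integral_circleExp_two_pi : ∫ y in (0 : ℝ)..2 * Real.pi, (Circle.exp y : ℂ) = 0 := by
  rw [intervalIntegral_circleExp]; simp

/-- A function of the form `e^{iθ_l} G` with `G` independent of `θ_l` has mean zero. -/
theorem mean_eq_zero_of_exp {l : Fin n} {H : (Fin n → ℝ) → ℂ} {θ : Fin n → ℝ} {c : ℂ}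
    (h : ∀ y, H (Function.update θ l y) = Circle.exp y * c) : mean l H θ = 0 := by
  simp only [mean, h, intervalIntegral.integral_mul_const, integral_circleExp_two_pi, zero_mul,
    mul_zero]

theorem mean_osc (l : Fin n) (θ : Fin n → ℝ) : mean l osc θ = 0 :=
  mean_eq_zero_of_exp fun y => osc_update θ l y

theorem norm_mean_le_of_close {l : Fin n} {H : (Fin n → ℝ) → ℂ} (hH : Continuous H) {δ : ℝ}
    (hclose : ∀ θ, ‖H θ - osc θ‖ ≤ δ) (θ : Fin n → ℝ) : ‖mean l H θ‖ ≤ δ := by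
  have h := mean_sub (l := l) hH (analyticOnNhd_osc (n := n)).continuous θ
  rw [mean_osc, sub_zero] at h
  rw [← h]
  exact norm_mean_le fun x => hclose _

/-- Differentiation under the mean: a function with vanishing means over `θ_l` has partial
derivatives with vanishing means. -/
theorem mean_fderiv_eq_zero {l j : Fin n} (hjl : j ≠ l) {K : (Fin n → ℝ) → ℂ}
    (hK : AnalyticOnNhd ℝ K univ) (h0 : ∀ θ, mean l K θ = 0) (θ : Fin n → ℝ) :
    mean l (fun θ => fderiv ℝ K θ (Pi.single j 1)) θ = 0 := by
  let e : Fin n → ℝ := Pi.single j 1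
  let K' : (Fin n → ℝ) → ℂ := fun θ => fderiv ℝ K θ e
  have hK' : Continuous K' := continuous_iff_continuousAt.2 fun θ =>
    (analyticAt_fderiv_apply hK e θ).continuousAt
  have hline : Continuous fun q : ℝ × ℝ => Function.update θ l q.2 + q.1 • e := by
    have h1 : Continuous fun q : ℝ × ℝ => Function.update θ l q.2 :=
      continuous_const.update l continuous_snd
    fun_prop
  obtain ⟨M, hM⟩ := (isCompact_Icc.prod isCompact_Icc :
    IsCompact (Icc (-1 : ℝ) 1 ×ˢ Icc (0 : ℝ) (2 * Real.pi))).exists_bound_of_continuousOn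
      (hK'.comp hline).continuousOn
  have hd := (intervalIntegral.hasDerivAt_integral_of_dominated_loc_of_deriv_le
    (F := fun (x y : ℝ) => K (Function.update θ l y + x • e))
    (F' := fun x y => K' (Function.update θ l y + x • e)) (x₀ := 0) (s := Icc (-1) 1)
    (a := 0) (b := 2 * Real.pi) (bound := fun _ => M) (μ := volume)
    (Icc_mem_nhds (by norm_num) (by norm_num))
    (Eventually.of_forall fun x => (hK.continuous.comp
      (hline.comp (by fun_prop : Continuous fun y => (x, y)))).aestronglyMeasurable)
    ((hK.continuous.comp
      (hline.comp (by fun_prop : Continuous fun y => ((0 : ℝ), y)))).intervalIntegrable _ _)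
    (hK'.comp (hline.comp (by fun_prop : Continuous fun y => ((0 : ℝ), y)))).aestronglyMeasurable
    (Eventually.of_forall fun y hy x hx => by
      rw [uIoc_of_le Real.two_pi_pos.le] at hy
      exact hM (x, y) ⟨hx, Ioc_subset_Icc_self hy⟩)
    (by simp)
    (Eventually.of_forall fun y _ x _ => by
      have h1 : HasDerivAt (fun x : ℝ => Function.update θ l y + x • e) e x := by
        simpa using ((hasDerivAt_id x).smul_const e).const_add (Function.update θ l y)
      exact (hK _ trivial).differentiableAt.hasFDerivAt.comp_hasDerivAt x h1)).2
  have hz : (fun x : ℝ => ∫ y in (0 : ℝ)..2 * Real.pi, K (Function.update θ l y + x • e)) =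
      fun _ => 0 := by
    funext x
    have := h0 (θ + x • e)
    simp only [mean, e, update_add_single hjl] at this
    refine (mul_eq_zero.1 this).resolve_left (inv_ne_zero ?_)
    exact_mod_cast Real.two_pi_pos.ne'
  rw [hz] at hd
  have := hd.unique (hasDerivAt_const _ _)
  simp only [zero_smul, add_zero] at this
  simp only [mean]
  change _ * ∫ y in (0 : ℝ)..2 * Real.pi, K' (Function.update θ l y) = 0
  rw [this, mul_zero]

/-- The primitive of `H - mean j H` in the direction `θ_j`, a periodic function. -/
noncomputable def periodicPrimitive (j : Fin n) (H : (Fin n → ℝ) → ℂ) (θ : Fin n → ℝ) : ℂ :=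
  primitive j H θ - θ j * mean j H θ

variable {H : (Fin n → ℝ) → ℂ} {j l : Fin n}

theorem analyticOnNhd_periodicPrimitive (hH : AnalyticOnNhd ℝ H univ) :
    AnalyticOnNhd ℝ (periodicPrimitive j H) univ := fun θ hθ =>
  (analyticOnNhd_primitive hH j θ hθ).sub
    ((analyticAt_ofReal (analyticAt_coord analyticAt_id j)).mul (analyticOnNhd_mean hH j θ hθ))

theorem isPeriodic_periodicPrimitive (hH : Continuous H) (hper : IsPeriodic H) :
    IsPeriodic (periodicPrimitive j H) := fun _ _ h => primitive_of_cover_eq hH hper j h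

theorem hasDerivAt_periodicPrimitive (hH : Continuous H) (θ : Fin n → ℝ) (x : ℝ) :
    HasDerivAt (fun x : ℝ => periodicPrimitive j H (θ + x • Pi.single j 1))
      (H (θ + x • Pi.single j 1) - mean j H θ) x := by
  have hu : ∀ x : ℝ, θ + x • Pi.single j 1 = Function.update θ j (θ j + x) := by
    intro x; ext i
    by_cases hi : i = j
    · subst hi; simp
    · simp [hi]
  have h1 := (hasDerivAt_primitive hH j θ (θ j + x)).comp_const_add (θ j) x
  have h2 : HasDerivAt (fun x : ℝ => ((θ j + x : ℝ) : ℂ) * mean j H θ) (mean j H θ) x := by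
    simpa using (((hasDerivAt_id x).const_add (θ j)).ofReal_comp).mul_const (mean j H θ)
  simp only [periodicPrimitive, mean_add_single]
  simp only [hu, Function.update_self]
  exact h1.sub h2

/-- For `H` close to `osc` the mean of the periodic primitive over another angle is small: for
`H = osc` it vanishes. -/
theorem norm_mean_periodicPrimitive_le (hjl : j ≠ l) (hH : Continuous H) (hper : IsPeriodic H)
    {δ : ℝ} (hclose : ∀ θ, ‖H θ - osc θ‖ ≤ δ) (hP : Continuous (periodicPrimitive j H))
    (θ : Fin n → ℝ) : ‖mean l (periodicPrimitive j H) θ‖ ≤ 4 * Real.pi * δ := by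
  -- by periodicity the angle `θ_j` may be taken in `[0, 2π]`
  wlog hθ : 0 ≤ θ j ∧ θ j ≤ 2 * Real.pi generalizing θ
  · let x := toIcoMod Real.two_pi_pos 0 (θ j)
    have hx := toIcoMod_mem_Ico Real.two_pi_pos 0 (θ j)
    rw [zero_add] at hx
    have hc : cover θ = cover (Function.update θ j x) := by
      conv_lhs => rw [← Function.update_eq_self j θ]
      refine cover_update rfl j ?_
      rw [Circle.exp_eq_exp]
      refine ⟨toIcoDiv Real.two_pi_pos 0 (θ j), ?_⟩
      rw [← zsmul_eq_mul, toIcoMod_add_toIcoDiv_zsmul]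
    rw [isPeriodic_mean (isPeriodic_periodicPrimitive hH hper) l _ _ hc]
    exact this _ (by simpa [x] using ⟨hx.1, hx.2.le⟩)
  have hosc : Continuous (osc (n := n)) := analyticOnNhd_osc.continuous
  have hprim : Continuous (primitive j (osc (n := n))) :=
    (analyticOnNhd_primitive analyticOnNhd_osc j).continuous
  have h1 : mean l (primitive j osc) θ = 0 := by
    refine mean_eq_zero_of_exp (c := ∫ x in (0 : ℝ)..θ j,
      osc (Function.update (Function.update θ j x) l 0)) fun y => ?_
    rw [primitive, Function.update_of_ne hjl, ← intervalIntegral.integral_const_mul]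
    refine intervalIntegral.integral_congr fun x _ => ?_
    rw [Function.update_comm hjl.symm, osc_update]
  have h2 := mean_sub (l := l) hP hprim θ
  rw [h1, sub_zero] at h2
  rw [← h2]
  refine norm_mean_le fun y => ?_
  set ψ := Function.update θ l y with hψ
  have hψj : ψ j = θ j := Function.update_of_ne hjl _ _
  have h3 : periodicPrimitive j H ψ - primitive j osc ψ =
      (∫ x in (0 : ℝ)..ψ j, (H (Function.update ψ j x) - osc (Function.update ψ j x))) -
        ψ j * mean j H ψ := by
    rw [intervalIntegral.integral_sub ((continuous_update_line hH ψ j).intervalIntegrable _ _)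
      ((continuous_update_line hosc ψ j).intervalIntegrable _ _), periodicPrimitive, primitive,
      primitive]
    ring
  rw [h3]
  have h4 : ‖∫ x in (0 : ℝ)..ψ j, (H (Function.update ψ j x) - osc (Function.update ψ j x))‖ ≤
      δ * |ψ j - 0| :=
    intervalIntegral.norm_integral_le_of_norm_le_const fun ξ _ => hclose _
  have h5 := norm_mean_le_of_close (l := j) hH hclose ψ
  have h6 : |ψ j| ≤ 2 * Real.pi := by rw [hψj, abs_of_nonneg hθ.1]; exact hθ.2
  have hδ : 0 ≤ δ := (norm_nonneg _).trans h5
  have h7 : ‖(ψ j : ℂ) * mean j H ψ‖ ≤ 2 * Real.pi * δ := by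
    rw [norm_mul, Complex.norm_real, Real.norm_eq_abs]
    gcongr
  rw [sub_zero] at h4
  have h8 : δ * |ψ j| ≤ δ * (2 * Real.pi) := by gcongr
  calc _ ≤ _ := norm_sub_le _ _
    _ ≤ _ := by linarith

end Mean

/-! ### The shear equation -/

section ShearEquation

open scoped ComplexConjugate

variable {n : ℕ}

/-- The displacement `Re (t̄ e^{iy})`: a function of the angle `y` with prescribed first Fourier
coefficient `t / 2`. -/
noncomputable def disp (t : ℂ) (y : ℝ) : ℝ := (conj t * (Circle.exp y : ℂ)).re

theorem abs_disp_le (t : ℂ) (y : ℝ) : |disp t y| ≤ ‖t‖ := by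
  refine (Complex.abs_re_le_norm _).trans ?_
  rw [norm_mul, Complex.norm_conj, Circle.norm_coe, mul_one]

theorem disp_sub (t t' : ℂ) (y : ℝ) : disp (t - t') y = disp t y - disp t' y := by
  simp [disp, sub_mul]

theorem continuous_disp (t : ℂ) : Continuous (disp t) :=
  Complex.continuous_re.comp (continuous_const.mul (by fun_prop))

theorem analyticAt_disp {E : Type*} [NormedAddCommGroup E] [NormedSpace ℝ E] {f : E → ℂ}
    {g : E → ℝ} {x : E} (hf : AnalyticAt ℝ f x) (hg : AnalyticAt ℝ g x) :
    AnalyticAt ℝ (fun x => disp (f x) (g x)) x := by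
  have h1 : AnalyticAt ℝ (fun x => conj (f x)) x :=
    (Complex.conjCLE.toContinuousLinearMap.analyticAt _).comp hf
  exact (Complex.reCLM.analyticAt _).comp (h1.mul (analyticAt_circleExp hg))

theorem integral_disp_mul_exp (t : ℂ) :
    ∫ y in (0 : ℝ)..2 * Real.pi, (disp t y : ℂ) * (Circle.exp y : ℂ) = Real.pi * t := by
  have h1 : ∀ y : ℝ, (disp t y : ℂ) * (Circle.exp y : ℂ) =
      conj t / 2 * Complex.exp (2 * Complex.I * y) + t / 2 := by
    intro y
    have h2 : ((disp t y : ℝ) : ℂ) =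
        (conj t * (Circle.exp y : ℂ) + t * conj (Circle.exp y : ℂ)) / 2 := by
      rw [disp, Complex.re_eq_add_conj]; simp
    have h3 : conj (Circle.exp y : ℂ) * (Circle.exp y : ℂ) = 1 := by
      rw [Complex.conj_mul', Circle.norm_coe]; simp
    have h4 : (Circle.exp y : ℂ) * (Circle.exp y : ℂ) = Complex.exp (2 * Complex.I * y) := by
      rw [Circle.coe_exp, ← Complex.exp_add]; ring_nf
    rw [h2, ← h4]
    linear_combination (t / 2) * h3
  simp only [h1]
  rw [intervalIntegral.integral_add (Continuous.intervalIntegrable (by fun_prop) _ _)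
    (Continuous.intervalIntegrable (by fun_prop) _ _), intervalIntegral.integral_const_mul,
    integral_exp_mul_complex (by simp [Complex.I_ne_zero])]
  have h5 : Complex.exp (2 * Complex.I * ((2 * Real.pi : ℝ) : ℂ)) = 1 := by
    have := Complex.exp_nat_mul_two_pi_mul_I 2
    rw [← this]; push_cast; ring_nf
  rw [h5]
  simp
  ring

/-- The equation `defect l j H θ t = 0` for `t = t(θ)` determines the shear
`S(θ) = θ - s(θ) e_j`, `s = Re (t̄ e^{iθ_l})`, which removes the dependence on `θ_j` of the mean
over `θ_l`. With `P = periodicPrimitive j H` it says that `P ∘ S - s · mean j H` has mean zero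
over `θ_l`; the derivative of this function in the direction `θ_j` is
`(H ∘ S) (1 - ∂_j s) - mean j H`. -/
noncomputable def defect (l j : Fin n) (H : (Fin n → ℝ) → ℂ) (θ : Fin n → ℝ) (t : ℂ) : ℂ :=
  (2 * Real.pi : ℂ)⁻¹ * ∫ y in (0 : ℝ)..2 * Real.pi,
    (periodicPrimitive j H (Function.update θ l y - disp t y • Pi.single j 1) -
      disp t y * mean j H (Function.update θ l y))

variable {H : (Fin n → ℝ) → ℂ} {j l : Fin n} {δ ρ : ℝ}

theorem analyticOnNhd_defect (hH : AnalyticOnNhd ℝ H univ) :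
    AnalyticOnNhd ℝ (fun q : (Fin n → ℝ) × ℂ => defect l j H q.1 q.2) univ := by
  have := analyticOnNhd_intervalIntegral (k := fun q : ((Fin n → ℝ) × ℂ) × ℝ =>
    (periodicPrimitive j H (Function.update q.1.1 l q.2 - disp q.1.2 q.2 • Pi.single j 1) -
      disp q.1.2 q.2 * mean j H (Function.update q.1.1 l q.2))) (fun q _ => by
    have h1 : AnalyticAt ℝ (fun q : ((Fin n → ℝ) × ℂ) × ℝ => q.1.1) q :=
      analyticAt_fst.comp analyticAt_fst
    have h2 : AnalyticAt ℝ (fun q : ((Fin n → ℝ) × ℂ) × ℝ => q.1.2) q :=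
      analyticAt_snd.comp analyticAt_fst
    have h3 := analyticAt_update h1 (analyticAt_snd (p := q)) l
    have h4 := analyticAt_disp h2 (analyticAt_snd (p := q))
    exact ((analyticOnNhd_periodicPrimitive hH _ trivial).comp
      (h3.sub (h4.smul analyticAt_const))).sub
      ((analyticAt_ofReal h4).mul ((analyticOnNhd_mean hH j _ trivial).comp h3)))
    Real.two_pi_pos.le
  exact fun q hq => analyticAt_const.mul (this q hq)

theorem defect_congr (hH : Continuous H) (hper : IsPeriodic H) {θ θ' : Fin n → ℝ}
    (h : ∀ y, cover (Function.update θ l y) = cover (Function.update θ' l y)) (t : ℂ) :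
    defect l j H θ t = defect l j H θ' t := by
  simp only [defect]
  congr 1
  refine intervalIntegral.integral_congr fun y _ => ?_
  have h1 : cover (Function.update θ l y - disp t y • Pi.single j 1) =
      cover (Function.update θ' l y - disp t y • Pi.single j 1) := by
    obtain ⟨m, hm⟩ := cover_eq_iff.1 (h y)
    refine cover_eq_iff.2 ⟨m, ?_⟩
    rw [hm]; abel
  rw [isPeriodic_periodicPrimitive hH hper _ _ h1, isPeriodic_mean hper j _ _ (h y)]

/-- As a function of `t`, the defect is a small Lipschitz perturbation of a linear isomorphism. -/
theorem norm_defect_sub_add_le (hH : AnalyticOnNhd ℝ H univ) (hclose : ∀ θ, ‖H θ - osc θ‖ ≤ δ)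
    (θ : Fin n → ℝ) {t t' : ℂ} (ht : ‖t‖ ≤ ρ) (ht' : ‖t'‖ ≤ ρ) :
    ‖defect l j H θ t - defect l j H θ t' + osc (Function.update θ l 0) * (t - t') / 2‖ ≤
      (δ + ρ) * ‖t - t'‖ := by
  let m := mean j H
  let P := periodicPrimitive j H
  have hP : Continuous P := (analyticOnNhd_periodicPrimitive hH).continuous
  have hm : Continuous m := (analyticOnNhd_mean hH j).continuous
  have hupd : Continuous fun y : ℝ => Function.update θ l y :=
    continuous_const.update l continuous_id
  have hexp : Continuous fun y : ℝ => (Circle.exp y : ℂ) := by fun_prop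
  have hdisp := continuous_disp
  have hdispc : ∀ t, Continuous fun y => (disp t y : ℂ) := fun t =>
    Complex.continuous_ofReal.comp (hdisp t)
  have hint : ∀ t, Continuous fun y : ℝ => P (Function.update θ l y - disp t y • Pi.single j 1) -
      disp t y * m (Function.update θ l y) := fun t =>
    (hP.comp (hupd.sub ((hdisp t).smul continuous_const))).sub ((hdispc t).mul (hm.comp hupd))
  have hpi : (Real.pi : ℂ) ≠ 0 := by exact_mod_cast Real.pi_ne_zero
  -- pointwise estimate: the primitive of `H - osc` is Lipschitz along lines
  have key : ∀ y : ℝ, ‖(P (Function.update θ l y - disp t y • Pi.single j 1) -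
      disp t y * m (Function.update θ l y)) -
      (P (Function.update θ l y - disp t' y • Pi.single j 1) -
      disp t' y * m (Function.update θ l y)) +
      (disp (t - t') y : ℂ) * (Circle.exp y : ℂ) * osc (Function.update θ l 0)‖ ≤
      (δ + ρ) * ‖t - t'‖ := by
    intro y
    set ψ := Function.update θ l y with hψ
    have hd : ∀ x : ℝ, HasDerivAt (fun x : ℝ => P (ψ + x • Pi.single j 1) + x * m ψ - x * osc ψ)
        (H (ψ + x • Pi.single j 1) - osc ψ) x := by
      intro x
      have h1 := hasDerivAt_periodicPrimitive (j := j) hH.continuous ψ x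
      have h2 : ∀ c : ℂ, HasDerivAt (fun x : ℝ => (x : ℂ) * c) c x := fun c => by
        simpa using ((hasDerivAt_id x).ofReal_comp).mul_const c
      have h3 := (h1.add (h2 (m ψ))).sub (h2 (osc ψ))
      refine h3.congr_deriv ?_
      simp only [m]; ring
    have hb : ∀ x ∈ Icc (-ρ) ρ, ‖H (ψ + x • Pi.single j 1) - osc ψ‖ ≤ δ + ρ := by
      intro x hx
      have h1 := hclose (ψ + x • Pi.single j 1)
      have h2 := norm_osc_add_single_sub_le ψ j x
      have h3 : |x| ≤ ρ := abs_le.2 hx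
      calc _ = ‖(H (ψ + x • Pi.single j 1) - osc (ψ + x • Pi.single j 1)) +
            (osc (ψ + x • Pi.single j 1) - osc ψ)‖ := by congr 1; ring
        _ ≤ _ := norm_add_le _ _
        _ ≤ _ := by linarith
    have hmem : ∀ s : ℂ, ‖s‖ ≤ ρ → -disp s y ∈ Icc (-ρ) ρ := fun s hs => by
      have := abs_le.1 ((abs_disp_le s y).trans hs)
      exact ⟨by linarith [this.2], by linarith [this.1]⟩
    have h1 := (convex_Icc (-ρ) ρ).norm_image_sub_le_of_norm_hasDerivWithin_le
      (fun x _ => (hd x).hasDerivWithinAt) hb (hmem t' ht') (hmem t ht)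
    have hδρ : 0 ≤ δ + ρ := (norm_nonneg _).trans (hb _ (hmem t ht))
    have h2 : ‖-disp t y - -disp t' y‖ ≤ ‖t - t'‖ := by
      have := abs_disp_le (t - t') y
      rw [disp_sub] at this
      rwa [Real.norm_eq_abs, ← abs_neg,
        show -(-disp t y - -disp t' y) = disp t y - disp t' y by ring]
    have h3 : osc ψ = (Circle.exp y : ℂ) * osc (Function.update θ l 0) := osc_update θ l y
    refine le_trans (le_of_eq ?_) (h1.trans (mul_le_mul_of_nonneg_left h2 hδρ))
    congr 1
    rw [h3, disp_sub]
    simp only [neg_smul, ← sub_eq_add_neg]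
    push_cast
    ring
  have hO : (2 * Real.pi : ℂ)⁻¹ * ∫ y in (0 : ℝ)..2 * Real.pi,
      ((disp (t - t') y : ℂ) * (Circle.exp y : ℂ) * osc (Function.update θ l 0)) =
      osc (Function.update θ l 0) * (t - t') / 2 := by
    rw [intervalIntegral.integral_mul_const, integral_disp_mul_exp]
    field_simp
  have h4 : defect l j H θ t - defect l j H θ t' + osc (Function.update θ l 0) * (t - t') / 2 =
      (2 * Real.pi : ℂ)⁻¹ * ∫ y in (0 : ℝ)..2 * Real.pi,
        ((P (Function.update θ l y - disp t y • Pi.single j 1) -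
          disp t y * m (Function.update θ l y)) -
        (P (Function.update θ l y - disp t' y • Pi.single j 1) -
          disp t' y * m (Function.update θ l y)) +
        (disp (t - t') y : ℂ) * (Circle.exp y : ℂ) * osc (Function.update θ l 0)) := by
    have hsplit : ∀ {f g h : ℝ → ℂ}, Continuous f → Continuous g → Continuous h →
        ∫ y in (0 : ℝ)..2 * Real.pi, (f y - g y + h y) =
          (∫ y in (0 : ℝ)..2 * Real.pi, f y) - (∫ y in (0 : ℝ)..2 * Real.pi, g y) +
            ∫ y in (0 : ℝ)..2 * Real.pi, h y := fun {f g h} hf hg hh => by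
      rw [intervalIntegral.integral_add (f := fun y => f y - g y)
        ((hf.sub hg).intervalIntegrable _ _)
        (hh.intervalIntegrable _ _), intervalIntegral.integral_sub (hf.intervalIntegrable _ _)
        (hg.intervalIntegrable _ _)]
    have e := hsplit (hint t) (hint t') (((hdispc (t - t')).mul hexp).mul
      (continuous_const (y := osc (Function.update θ l 0))))
    simp only [Pi.mul_apply] at e
    rw [← hO, e, defect, defect]
    ring
  have h5 := intervalIntegral.norm_integral_le_of_norm_le_const (a := 0) (b := 2 * Real.pi)
    (fun y _ => key y)
  rw [sub_zero, abs_of_pos Real.two_pi_pos] at h5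
  have h6 : ‖(2 * Real.pi : ℂ)⁻¹‖ = (2 * Real.pi)⁻¹ := by
    rw [norm_inv, norm_mul, Complex.norm_real, Real.norm_of_nonneg Real.pi_pos.le]; simp
  rw [h4, norm_mul, h6, inv_mul_le_iff₀ Real.two_pi_pos]
  linarith

/-- The shear equation has at most one small solution. -/
theorem defect_injOn (hH : AnalyticOnNhd ℝ H univ) (hclose : ∀ θ, ‖H θ - osc θ‖ ≤ δ)
    (hδρ : δ + ρ ≤ 1 / 4) (θ : Fin n → ℝ) {t t' : ℂ} (ht : ‖t‖ ≤ ρ) (ht' : ‖t'‖ ≤ ρ)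
    (h : defect l j H θ t = defect l j H θ t') : t = t' := by
  have h1 := norm_defect_sub_add_le (l := l) (j := j) hH hclose θ ht ht'
  rw [h, sub_self, zero_add, norm_div, norm_mul, norm_osc, one_mul, RCLike.norm_two] at h1
  have h2 := norm_nonneg (t - t')
  have h3 : ‖t - t'‖ = 0 := by nlinarith
  exact sub_eq_zero.1 (norm_eq_zero.1 h3)

theorem norm_defect_zero_le (hjl : j ≠ l) (hH : AnalyticOnNhd ℝ H univ) (hper : IsPeriodic H)
    (hclose : ∀ θ, ‖H θ - osc θ‖ ≤ δ) (θ : Fin n → ℝ) :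
    ‖defect l j H θ 0‖ ≤ 4 * Real.pi * δ := by
  have h := norm_mean_periodicPrimitive_le hjl hH.continuous hper hclose
    (analyticOnNhd_periodicPrimitive hH).continuous θ
  simpa [defect, mean, disp] using h

/-- The shear equation has a small solution. -/
theorem exists_defect_eq_zero (hjl : j ≠ l) (hH : AnalyticOnNhd ℝ H univ) (hper : IsPeriodic H)
    (hclose : ∀ θ, ‖H θ - osc θ‖ ≤ δ) (hδρ : δ + ρ ≤ 1 / 4) (hδ : 64 * δ ≤ ρ)
    (θ : Fin n → ℝ) : ∃ t, ‖t‖ ≤ ρ ∧ defect l j H θ t = 0 := by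
  have hδ0 : 0 ≤ δ := (norm_nonneg _).trans (hclose 0)
  let O := osc (Function.update θ l 0)
  have hO : ‖O‖ = 1 := norm_osc _
  have hO0 : O ≠ 0 := by intro h; rw [h, norm_zero] at hO; exact zero_ne_one hO
  -- after normalization the equation is a perturbation of the identity
  let F : ℂ → ℂ := fun t => -2 * O⁻¹ * defect l j H θ t
  have hF : ApproximatesLinearOn F ((ContinuousLinearEquiv.refl ℝ ℂ : ℂ ≃L[ℝ] ℂ) : ℂ →L[ℝ] ℂ)
      (Metric.closedBall 0 ρ) (1 / 2) := by
    intro t ht t' ht'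
    have h1 := norm_defect_sub_add_le (l := l) (j := j) hH hclose θ
      (mem_closedBall_zero_iff.1 ht) (mem_closedBall_zero_iff.1 ht')
    have h2 : F t - F t' - (t - t') = -2 * O⁻¹ *
        (defect l j H θ t - defect l j H θ t' + O * (t - t') / 2) := by
      simp only [F]; field_simp; ring
    simp only [ContinuousLinearEquiv.coe_coe, ContinuousLinearEquiv.coe_refl', id]
    rw [h2, norm_mul, norm_mul, norm_neg, RCLike.norm_two, norm_inv, hO]
    push_cast
    have := norm_nonneg (t - t')
    nlinarith
  have hρ : 0 ≤ ρ := by linarith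
  have hsurj := hF.surjOn_closedBall_of_nonlinearRightInverse
    (ContinuousLinearEquiv.refl ℝ ℂ).toNonlinearRightInverse hρ le_rfl
  have hnorm : ((ContinuousLinearEquiv.refl ℝ ℂ).toNonlinearRightInverse.nnnorm : ℝ) = 1 := by
    change ‖ContinuousLinearMap.id ℝ ℂ‖ = 1
    simp
  have h0 : (0 : ℂ) ∈ Metric.closedBall (F 0)
      ((((ContinuousLinearEquiv.refl ℝ ℂ).toNonlinearRightInverse.nnnorm : ℝ)⁻¹ -
        ((1 / 2 : NNReal) : ℝ)) * ρ) := by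
    rw [hnorm, Metric.mem_closedBall, dist_comm, dist_zero_right]
    simp only [F]
    rw [norm_mul, norm_mul, norm_neg, RCLike.norm_two, norm_inv, hO]
    have h1 := norm_defect_zero_le hjl hH hper hclose θ
    push_cast
    have h2 : Real.pi * δ ≤ 4 * δ := by
      gcongr; exact Real.pi_lt_four.le
    linarith
  obtain ⟨t, ht, hFt⟩ := hsurj h0
  refine ⟨t, mem_closedBall_zero_iff.1 ht, ?_⟩
  exact (mul_eq_zero.1 hFt).resolve_left (mul_ne_zero (by norm_num) (inv_ne_zero hO0))

/-- A small solution of the shear equation depends analytically on `θ`: the map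
`(θ, t) ↦ (θ, defect l j H θ t)` can be inverted. -/
theorem analyticAt_of_defect_eq_zero (hH : AnalyticOnNhd ℝ H univ)
    (hclose : ∀ θ, ‖H θ - osc θ‖ ≤ δ) (hδρ : δ + ρ ≤ 1 / 4) {t : (Fin n → ℝ) → ℂ}
    (ht : ∀ θ, ‖t θ‖ < ρ) (h0 : ∀ θ, defect l j H θ (t θ) = 0) (θ : Fin n → ℝ) :
    AnalyticAt ℝ t θ := by
  let Ψ : (Fin n → ℝ) × ℂ → (Fin n → ℝ) × ℂ := fun q => (q.1, defect l j H q.1 q.2)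
  let U : Set ((Fin n → ℝ) × ℂ) := {q | ‖q.2‖ < ρ}
  have hU : IsOpen U := isOpen_lt (by fun_prop) continuous_const
  have hda : AnalyticOnNhd ℝ (fun q : (Fin n → ℝ) × ℂ => defect l j H q.1 q.2) univ :=
    analyticOnNhd_defect hH
  have hΨ : AnalyticOnNhd ℝ Ψ U := fun q _ => analyticAt_fst.prod (hda q trivial)
  have hinj : InjOn Ψ U := by
    rintro ⟨θ₁, t₁⟩ h1 ⟨θ₂, t₂⟩ h2 h
    obtain ⟨h3, h4⟩ := Prod.ext_iff.1 h
    simp only [Ψ] at h3 h4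
    subst h3
    exact Prod.ext rfl (defect_injOn hH hclose hδρ θ₁ (le_of_lt h1) (le_of_lt h2) h4)
  have hder : ∀ q ∈ U, Function.Injective (fderiv ℝ Ψ q) := by
    rintro ⟨θ₁, t₁⟩ h1
    let D := fderiv ℝ (fun q : (Fin n → ℝ) × ℂ => defect l j H q.1 q.2) (θ₁, t₁)
    have hD : HasFDerivAt (fun q : (Fin n → ℝ) × ℂ => defect l j H q.1 q.2) D (θ₁, t₁) :=
      (hda _ trivial).differentiableAt.hasFDerivAt
    have hΨd : HasFDerivAt Ψ ((ContinuousLinearMap.fst ℝ _ _).prod D) (θ₁, t₁) :=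
      hasFDerivAt_fst.prodMk hD
    rw [hΨd.fderiv, injective_iff_map_eq_zero]
    rintro ⟨v, τ⟩ hv
    obtain ⟨hv1, hv2⟩ := Prod.ext_iff.1 hv
    simp only [ContinuousLinearMap.prod_apply, ContinuousLinearMap.coe_fst', Prod.fst_zero,
      Prod.snd_zero] at hv1 hv2
    subst hv1
    let O := osc (Function.update θ₁ l 0)
    -- the derivative in `t` is within `1 / 4` of `-O / 2`
    have hpart : HasFDerivAt (fun t => defect l j H θ₁ t + O / 2 * t)
        (D.comp (ContinuousLinearMap.inr ℝ _ _) +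
          (O / 2) • ContinuousLinearMap.id ℝ ℂ) t₁ := by
      have h2 : HasFDerivAt (fun t : ℂ => (θ₁, t)) (ContinuousLinearMap.inr ℝ (Fin n → ℝ) ℂ) t₁ :=
        hasFDerivAt_prodMk_right θ₁ t₁
      exact (hD.comp t₁ h2).add ((hasFDerivAt_id t₁).const_smul (O / 2))
    have hδρ0 : 0 ≤ δ + ρ := by
      have := (norm_nonneg _).trans (hclose 0)
      have := (norm_nonneg _).trans (le_of_lt (show ‖t₁‖ < ρ from h1))
      linarith
    have hbound := hpart.le_of_lip' hδρ0 (by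
      filter_upwards [(isOpen_lt continuous_norm continuous_const).mem_nhds
        (show ‖t₁‖ < ρ from h1)] with t₂ h2
      have := norm_defect_sub_add_le (l := l) (j := j) hH hclose θ₁ (le_of_lt h2)
        (le_of_lt (show ‖t₁‖ < ρ from h1))
      refine le_trans (le_of_eq ?_) this
      congr 1
      simp only [O]; ring)
    have h3 := (ContinuousLinearMap.le_opNorm _ τ).trans
      (mul_le_mul_of_nonneg_right hbound (norm_nonneg τ))
    simp only [_root_.add_apply, ContinuousLinearMap.comp_apply,
      ContinuousLinearMap.inr_apply, _root_.smul_apply,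
      ContinuousLinearMap.id_apply, hv2, zero_add, smul_eq_mul, norm_mul, norm_div] at h3
    rw [norm_osc, RCLike.norm_two] at h3
    have h4 := norm_nonneg τ
    have h5 : ‖τ‖ = 0 := by nlinarith
    rw [norm_eq_zero.1 h5]; rfl
  have hg := analyticAt_of_comp_injOn hU hΨ hinj hder (g := fun θ => (θ, t θ)) (fun θ => ht θ)
    (x₀ := θ) (by simp only [Ψ, h0]; exact analyticAt_id.prod analyticAt_const)
  exact analyticAt_snd.comp hg

end ShearEquation

/-! ### Removing the dependence of the means on the angles one at a time -/

section ShearStep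

open scoped ComplexConjugate

variable {n : ℕ} {H : (Fin n → ℝ) → ℂ} {j l : Fin n}

theorem mean_disp_mul_osc (θ : Fin n → ℝ) (w : ℂ) :
    (2 * Real.pi : ℂ)⁻¹ * ∫ y in (0 : ℝ)..2 * Real.pi,
      (disp w y : ℂ) * osc (Function.update θ l y) = osc (Function.update θ l 0) * w / 2 := by
  have h : ∀ y : ℝ, (disp w y : ℂ) * osc (Function.update θ l y) =
      (disp w y : ℂ) * (Circle.exp y : ℂ) * osc (Function.update θ l 0) := fun y => by
    rw [osc_update θ l y, mul_assoc]
  have hpi : (Real.pi : ℂ) ≠ 0 := by exact_mod_cast Real.pi_ne_zero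
  simp only [h]
  rw [intervalIntegral.integral_mul_const, integral_disp_mul_exp]
  field_simp

/-- For a density `H` close to `osc` there is a change of the angle `θ_j` which replaces `H` by a
density `H'` whose mean over `θ_l` is that of `H`, averaged over `θ_j`. -/
theorem exists_shear (hjl : j ≠ l) (hH : AnalyticOnNhd ℝ H univ) (hper : IsPeriodic H)
    {ρ δ : ℝ} (hρ : 0 < ρ) (hρ1 : ρ ≤ 1 / 24) (hδ : 64 * δ ≤ ρ)
    (hclose : ∀ θ, ‖H θ - osc θ‖ ≤ δ) :
    ∃ H' : (Fin n → ℝ) → ℂ, AnalyticOnNhd ℝ H' univ ∧ IsPeriodic H' ∧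
      (∀ θ, ‖H' θ - osc θ‖ ≤ 26 * ρ) ∧ (Realizable H' → Realizable H) ∧
      ∀ θ, mean l H' θ = mean l (mean j H) θ := by
  have hδ0 : 0 ≤ δ := (norm_nonneg _).trans (hclose 0)
  have hδρ : δ + 2 * ρ ≤ 1 / 4 := by linarith
  choose t ht ht0 using exists_defect_eq_zero (ρ := ρ) hjl hH hper hclose (by linarith) hδ
  have ht2 : ∀ θ, ‖t θ‖ ≤ 2 * ρ := fun θ => (ht θ).trans (by linarith)
  have hta : AnalyticOnNhd ℝ t univ := fun θ _ =>
    analyticAt_of_defect_eq_zero (ρ := 2 * ρ) hH hclose hδρ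
      (fun θ => (ht θ).trans_lt (by linarith)) ht0 θ
  -- `t` is periodic and independent of `θ_l`, by uniqueness
  have htu : ∀ θ θ', (∀ y, cover (Function.update θ l y) = cover (Function.update θ' l y)) →
      t θ = t θ' := fun θ θ' h =>
    defect_injOn hH hclose hδρ θ (ht2 θ) (ht2 θ') (by
      rw [ht0, defect_congr hH.continuous hper h, ht0])
  have htper : IsPeriodic t := fun θ θ' h => htu θ θ' fun y => cover_update h l rfl
  have htl : ∀ θ y, t (Function.update θ l y) = t θ := fun θ y => htu _ _ fun y => by simp
  let e : Fin n → ℝ := Pi.single j 1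
  let s : (Fin n → ℝ) → ℝ := fun θ => disp (t θ) (θ l)
  have hsa : AnalyticOnNhd ℝ s univ := fun θ _ =>
    analyticAt_disp (hta θ trivial) (analyticAt_coord analyticAt_id l)
  have hsper : IsPeriodic s := fun θ θ' h => by
    have h1 : Circle.exp (θ l) = Circle.exp (θ' l) := congrFun h l
    simp only [s, disp, htper θ θ' h, h1]
  have hsle : ∀ θ, |s θ| ≤ ρ := fun θ => (abs_disp_le _ _).trans (ht θ)
  -- the derivative of `s` in the direction `j` is the displacement given by that of `t`
  let w : (Fin n → ℝ) → ℂ := fun θ => fderiv ℝ t θ e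
  have hline : ∀ θ : Fin n → ℝ, HasDerivAt (fun x : ℝ => θ + x • e) e 0 := fun θ => by
    simpa using ((hasDerivAt_id (0 : ℝ)).smul_const e).const_add θ
  have hlined : ∀ {E : Type} [NormedAddCommGroup E] [NormedSpace ℝ E] {f : (Fin n → ℝ) → E}
      (θ : Fin n → ℝ), AnalyticAt ℝ f θ →
      HasDerivAt (fun x : ℝ => f (θ + x • e)) (fderiv ℝ f θ e) 0 := by
    intro E _ _ f θ hf
    have h1 : HasFDerivAt f (fderiv ℝ f θ) (θ + (0 : ℝ) • e) := by
      simpa using hf.differentiableAt.hasFDerivAt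
    exact h1.comp_hasDerivAt (0 : ℝ) (hline θ)
  have hds : ∀ θ, fderiv ℝ s θ e = disp (w θ) (θ l) := by
    intro θ
    have h1 := hlined θ (hta θ trivial)
    have h2 : HasDerivAt (fun x : ℝ => s (θ + x • e)) (disp (w θ) (θ l)) 0 := by
      have h3 := ((Complex.reCLM.hasFDerivAt (x := conj (t (θ + (0 : ℝ) • e)) *
        (Circle.exp (θ l) : ℂ))).comp_hasDerivAt (0 : ℝ)
        (((Complex.conjCLE.toContinuousLinearMap.hasFDerivAt
          (x := t (θ + (0 : ℝ) • e))).comp_hasDerivAt (0 : ℝ) h1).mul_const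
          (Circle.exp (θ l) : ℂ)))
      have h4 : ∀ x : ℝ, (θ + x • e) l = θ l := fun x => by simp [e, Ne.symm hjl]
      simp only [s, h4]
      exact h3
    exact (hlined θ (hsa θ trivial)).unique h2
  have hwl : ∀ θ y, w (Function.update θ l y) = w θ := by
    intro θ y
    have h1 := hlined θ (hta θ trivial)
    have h2 := hlined (Function.update θ l y) (hta _ trivial)
    simp only [e, ← update_add_single hjl, htl] at h2
    exact h2.unique h1
  let S : (Fin n → ℝ) → (Fin n → ℝ) := fun θ => θ - s θ • e
  have hSa : ∀ θ, AnalyticAt ℝ S θ := fun θ =>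
    analyticAt_id.sub ((hsa θ trivial).smul analyticAt_const)
  have hHSa : ∀ θ, AnalyticAt ℝ (fun θ => H (S θ)) θ := fun θ => (hH _ trivial).comp (hSa θ)
  have hHSc : Continuous fun θ => H (S θ) :=
    continuous_iff_continuousAt.2 fun θ => (hHSa θ).continuousAt
  have hdsa : ∀ θ, AnalyticAt ℝ (fun θ => ((1 - fderiv ℝ s θ e : ℝ) : ℂ)) θ := fun θ =>
    analyticAt_ofReal (analyticAt_const.sub (analyticAt_fderiv_apply hsa e θ))
  let H' : (Fin n → ℝ) → ℂ := fun θ => H (S θ) * ((1 - fderiv ℝ s θ e : ℝ) : ℂ)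
  have hH'a : AnalyticOnNhd ℝ H' univ := fun θ _ => (hHSa θ).mul (hdsa θ)
  have hScover : ∀ θ θ', cover θ = cover θ' → cover (S θ) = cover (S θ') := by
    intro θ θ' h
    obtain ⟨m, hm⟩ := cover_eq_iff.1 h
    refine cover_eq_iff.2 ⟨m, ?_⟩
    simp only [S]
    rw [hsper θ θ' h, hm]; abel
  have hHSper : ∀ θ θ', cover θ = cover θ' → H (S θ) = H (S θ') := fun θ θ' h =>
    hper _ _ (hScover θ θ' h)
  have hH'per : IsPeriodic H' := fun θ θ' h => by
    simp only [H']
    rw [hHSper θ θ' h, hsper.fderiv θ θ' h]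
  -- differentiating the equation of `t` in the direction `j`
  have hmean : ∀ θ, mean l H' θ = mean l (mean j H) θ := by
    let K : (Fin n → ℝ) → ℂ := fun θ => periodicPrimitive j H (S θ) - s θ * mean j H θ
    have hKa : AnalyticOnNhd ℝ K univ := fun θ _ =>
      ((analyticOnNhd_periodicPrimitive hH _ trivial).comp (hSa θ)).sub
        ((analyticAt_ofReal (hsa θ trivial)).mul (analyticOnNhd_mean hH j θ trivial))
    have hK0 : ∀ θ, mean l K θ = 0 := by
      intro θ
      rw [← ht0 θ]
      simp only [mean, K, defect, S, s, htl, Function.update_self, e]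
    have hKd : ∀ θ, fderiv ℝ K θ e = H' θ - mean j H θ := by
      intro θ
      have h1 := hlined θ (hKa θ trivial)
      have h2 : HasDerivAt (fun x : ℝ => x - s (θ + x • e)) (1 - fderiv ℝ s θ e) 0 :=
        (hasDerivAt_id (0 : ℝ)).sub (hlined θ (hsa θ trivial))
      have h3 := (hasDerivAt_periodicPrimitive (j := j) hH.continuous θ
        ((0 : ℝ) - s (θ + (0 : ℝ) • e))).scomp (0 : ℝ) h2
      have h4 : HasDerivAt (fun x : ℝ => ((s (θ + x • e) : ℝ) : ℂ) * mean j H θ)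
          ((fderiv ℝ s θ e : ℝ) * mean j H θ) 0 :=
        ((hlined θ (hsa θ trivial)).ofReal_comp).mul_const _
      have h5 := h3.sub h4
      have h6 : (fun x : ℝ => K (θ + x • e)) = fun x : ℝ =>
          periodicPrimitive j H (θ + (x - s (θ + x • e)) • e) -
            ((s (θ + x • e) : ℝ) : ℂ) * mean j H θ := by
        funext x
        simp only [K, S, e, mean_add_single, sub_smul, add_sub_assoc]
      rw [h6] at h1
      refine h1.unique (h5.congr_deriv ?_)
      simp only [H', S, zero_smul, add_zero, zero_sub, neg_smul, Complex.real_smul, e,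
        ← sub_eq_add_neg]
      push_cast
      ring
    intro θ
    have h7 := mean_fderiv_eq_zero hjl hKa hK0 θ
    have h8 : (fun θ => fderiv ℝ K θ (Pi.single j 1)) = fun θ => H' θ - mean j H θ :=
      funext hKd
    rw [h8, mean_sub hH'a.continuous (analyticOnNhd_mean hH j).continuous] at h7
    exact sub_eq_zero.1 h7
  have hHS : ∀ θ, ‖H (S θ) - osc θ‖ ≤ δ + ρ := by
    intro θ
    have h1 := hclose (S θ)
    have h2 := norm_osc_add_single_sub_le θ j (-s θ)
    have h3 : S θ = θ + (-s θ) • Pi.single j 1 := by simp only [S, e, neg_smul, sub_eq_add_neg]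
    rw [← h3, abs_neg] at h2
    calc _ = ‖(H (S θ) - osc (S θ)) + (osc (S θ) - osc θ)‖ := by congr 1; ring
      _ ≤ _ := norm_add_le _ _
      _ ≤ _ := by linarith [hsle θ]
  -- the first Fourier coefficient in `θ_l` of the mean identity bounds the derivative of `t`
  have hw : ∀ θ, ‖w θ‖ ≤ 12 * ρ := by
    intro θ
    let G : (Fin n → ℝ) → ℂ := fun θ => H (S θ) * (fderiv ℝ s θ e : ℝ)
    have hGc : Continuous G := continuous_iff_continuousAt.2 fun θ =>
      ((hHSa θ).mul (analyticAt_ofReal (analyticAt_fderiv_apply hsa e θ))).continuousAt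
    have hG : mean l G θ = mean l (fun θ => H (S θ)) θ - mean l (mean j H) θ := by
      have h2 := mean_sub (l := l) hHSc hGc θ
      have h3 : (fun θ => H (S θ) - G θ) = H' := by
        funext θ; simp only [G, H']; push_cast; ring
      rw [h3, hmean] at h2
      linear_combination h2
    have hGb : ‖mean l G θ‖ ≤ 2 * δ + ρ := by
      rw [hG]
      have h1 : ‖mean l (fun θ => H (S θ)) θ‖ ≤ δ + ρ := norm_mean_le_of_close hHSc hHS θ
      have h2 : ‖mean l (mean j H) θ‖ ≤ δ :=
        norm_mean_le fun x => norm_mean_le_of_close hH.continuous hclose _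
      exact (norm_sub_le _ _).trans (by linarith)
    let G₀ : (Fin n → ℝ) → ℂ := fun θ => (disp (w θ) (θ l) : ℂ) * osc θ
    have hG₀c : Continuous G₀ := by
      refine Continuous.mul ?_ analyticOnNhd_osc.continuous
      refine Complex.continuous_ofReal.comp ?_
      simp only [← hds]
      exact continuous_iff_continuousAt.2 fun θ => (analyticAt_fderiv_apply hsa e θ).continuousAt
    have hG₀ : mean l G₀ θ = osc (Function.update θ l 0) * w θ / 2 := by
      rw [← mean_disp_mul_osc]
      simp only [mean, G₀, hwl, Function.update_self]
    have hdiff : ‖mean l G θ - mean l G₀ θ‖ ≤ (δ + ρ) * ‖w θ‖ := by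
      rw [← mean_sub hGc hG₀c]
      refine norm_mean_le fun y => ?_
      simp only [G, G₀, hds, hwl, Function.update_self]
      rw [mul_comm, ← mul_sub, norm_mul, Complex.norm_real, Real.norm_eq_abs, mul_comm]
      have h1 := hHS (Function.update θ l y)
      have h2 := abs_disp_le (w θ) y
      gcongr
    have h1 : ‖w θ‖ / 2 = ‖mean l G₀ θ‖ := by
      rw [hG₀, norm_div, norm_mul, norm_osc, one_mul, RCLike.norm_two]
    have h2 : ‖mean l G₀ θ‖ ≤ ‖mean l G θ‖ + ‖mean l G θ - mean l G₀ θ‖ := by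
      have := norm_sub_le (mean l G θ) (mean l G θ - mean l G₀ θ)
      simpa using this
    have h3 : (δ + ρ) * ‖w θ‖ ≤ 1 / 4 * ‖w θ‖ := by gcongr; linarith
    linarith
  have hdsle : ∀ θ, |fderiv ℝ s θ e| ≤ 12 * ρ := fun θ => by
    rw [hds]; exact (abs_disp_le _ _).trans (hw θ)
  refine ⟨H', hH'a, hH'per, fun θ => ?_, ?_, hmean⟩
  · have h1 : H' θ - osc θ = (H (S θ) - osc θ) * ((1 - fderiv ℝ s θ e : ℝ) : ℂ) -
        osc θ * (fderiv ℝ s θ e : ℝ) := by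
      simp only [H']; push_cast; ring
    have h2 := abs_le.1 (hdsle θ)
    have h3 : |1 - fderiv ℝ s θ e| ≤ 2 := by rw [abs_le]; constructor <;> linarith
    rw [h1]
    refine (norm_sub_le _ _).trans ?_
    rw [norm_mul, norm_mul, norm_osc, one_mul, Complex.norm_real, Complex.norm_real,
      Real.norm_eq_abs, Real.norm_eq_abs]
    have h4 : ‖H (S θ) - osc θ‖ * |1 - fderiv ℝ s θ e| ≤ (δ + ρ) * 2 :=
      mul_le_mul (hHS θ) h3 (abs_nonneg _) (by linarith)
    linarith [hdsle θ]
  · exact Realizable.of_shear (j := j) hsa hsper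
      (fun θ => (hdsle θ).trans (by linarith)) (fun θ => rfl)

end ShearStep

/-! ### Reduction to vanishing means -/

section Reduction

variable {n : ℕ}

/-- The integral of a density over a fundamental domain of the torus. -/
noncomputable def boxIntegral (H : (Fin n → ℝ) → ℂ) : ℂ :=
  ∫ θ in Icc (0 : Fin n → ℝ) (fun _ => 2 * Real.pi), H θ

theorem integral_Icc_swap {α : Type*} [TopologicalSpace α] [Preorder α] [CompactIccSpace α]
    [T2Space α] [SecondCountableTopology α] [MeasurableSpace α] [BorelSpace α] (μ : Measure α)
    [IsFiniteMeasureOnCompacts μ] [SFinite μ] {f : ℝ → α → ℂ} (hf : Continuous (Function.uncurry f))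
    (a b : ℝ) (c d : α) :
    ∫ x in Icc a b, (∫ y in Icc c d, f x y ∂μ) = ∫ y in Icc c d, (∫ x in Icc a b, f x y) ∂μ := by
  apply integral_integral_swap
  rw [Measure.prod_restrict]
  exact hf.continuousOn.integrableOn_compact (isCompact_Icc.prod isCompact_Icc)

theorem mean_eq_integral_Icc (l : Fin n) (H : (Fin n → ℝ) → ℂ) (θ : Fin n → ℝ) :
    mean l H θ =
      (2 * Real.pi : ℂ)⁻¹ * ∫ x in Icc (0 : ℝ) (2 * Real.pi), H (Function.update θ l x) := by
  rw [mean, intervalIntegral.integral_of_le Real.two_pi_pos.le, integral_Icc_eq_integral_Ioc]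

theorem mean_comm {H : (Fin n → ℝ) → ℂ} (hH : Continuous H) {i j : Fin n} (hij : i ≠ j)
    (θ : Fin n → ℝ) : mean i (mean j H) θ = mean j (mean i H) θ := by
  have hc : Continuous (Function.uncurry fun x y : ℝ =>
      H (Function.update (Function.update θ i x) j y)) :=
    have h1 : Continuous fun q : ℝ × ℝ => Function.update θ i q.1 :=
      continuous_const.update i continuous_fst
    hH.comp (h1.update j continuous_snd)
  simp only [mean_eq_integral_Icc, integral_const_mul]
  rw [integral_Icc_swap volume hc]
  simp only [Function.update_comm hij]

/-- Fubini's theorem, with one angle separated from the others. -/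
theorem setIntegral_box_eq {m : ℕ} (l : Fin (m + 1)) {H : (Fin (m + 1) → ℝ) → ℂ}
    (hH : Continuous H) :
    boxIntegral H = ∫ x in Icc (0 : ℝ) (2 * Real.pi),
      ∫ y in Icc (0 : Fin m → ℝ) fun _ => 2 * Real.pi, H (l.insertNth x y) := by
  set e : ℝ × (Fin m → ℝ) ≃ᵐ (Fin (m + 1) → ℝ) :=
    (MeasurableEquiv.piFinSuccAbove (fun _ => ℝ) l).symm
  have hem : MeasurePreserving e :=
    (volume_preserving_piFinSuccAbove (fun _ : Fin (m + 1) => ℝ) l).symm _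
  have heπ : (e ⁻¹' Icc 0 fun _ => 2 * Real.pi) =
      Icc 0 (2 * Real.pi) ×ˢ Icc (0 : Fin m → ℝ) fun _ => 2 * Real.pi :=
    ((Fin.insertNthOrderIso (fun _ => ℝ) l).preimage_Icc _ _).trans (Icc_prod_eq _ _)
  have hi : IntegrableOn H (Icc (0 : Fin (m + 1) → ℝ) fun _ => 2 * Real.pi) :=
    hH.continuousOn.integrableOn_compact isCompact_Icc
  rw [boxIntegral, ← hem.map_eq, setIntegral_map_equiv, heπ, Measure.volume_eq_prod,
    setIntegral_prod]
  · rfl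
  · rwa [← hem.integrableOn_comp_preimage e.measurableEmbedding, heπ] at hi

theorem boxIntegral_mean {H : (Fin n → ℝ) → ℂ} (hH : Continuous H) (l : Fin n)
    (hm : Continuous (mean l H)) : boxIntegral (mean l H) = boxIntegral H := by
  obtain ⟨m, rfl⟩ : ∃ m, n = m + 1 := ⟨n - 1, (Nat.sub_add_cancel l.pos).symm⟩
  have hc : Continuous (Function.uncurry fun (x : ℝ) (y : Fin m → ℝ) =>
      H (l.insertNth x y)) := by
    refine hH.comp (continuous_pi fun i => ?_)
    refine Fin.succAboveCases l ?_ (fun i => ?_) i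
    · simpa using continuous_fst
    · simp only [Fin.insertNth_apply_succAbove]; fun_prop
  rw [setIntegral_box_eq l hm, setIntegral_box_eq l hH, integral_Icc_swap volume hc]
  have h1 : ∀ (x : ℝ) (y : Fin m → ℝ), mean l H (l.insertNth x y) =
      (2 * Real.pi : ℂ)⁻¹ * ∫ x in Icc (0 : ℝ) (2 * Real.pi), H (l.insertNth x y) := by
    intro x y
    rw [mean_eq_integral_Icc]
    simp only [Fin.update_insertNth]
  simp only [h1, integral_const_mul, setIntegral_const]
  have hpi : (2 * Real.pi : ℂ) ≠ 0 := by exact_mod_cast Real.two_pi_pos.ne'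
  rw [Real.volume_real_Icc_of_le Real.two_pi_pos.le, sub_zero, Complex.real_smul]
  push_cast
  rw [← mul_assoc, inv_mul_cancel₀ hpi, one_mul]

theorem eq_of_forall_update_eq {X : Type*} {f : (Fin n → ℝ) → X}
    (h : ∀ i θ x, f (Function.update θ i x) = f θ) (θ θ' : Fin n → ℝ) : f θ = f θ' := by
  have key : ∀ s : Finset (Fin n), f (s.piecewise θ θ') = f θ' := by
    intro s
    induction s using Finset.induction_on with
    | empty => simp
    | insert j s _ ih => rw [Finset.piecewise_insert, h, ih]
  simpa using key Finset.univ

/-- Iteration of `exists_shear` over the angles in a set `s`. -/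
theorem exists_mean_independent (l : Fin n) (s : Finset (Fin n)) (hs : l ∉ s) :
    ∀ η > 0, ∃ δ > 0, ∀ H : (Fin n → ℝ) → ℂ, AnalyticOnNhd ℝ H univ → IsPeriodic H →
      (∀ θ, ‖H θ - osc θ‖ ≤ δ) →
      ∃ H' : (Fin n → ℝ) → ℂ, AnalyticOnNhd ℝ H' univ ∧ IsPeriodic H' ∧
        (∀ θ, ‖H' θ - osc θ‖ ≤ η) ∧ (Realizable H' → Realizable H) ∧
        (∀ i ∈ s, ∀ θ x, mean l H' (Function.update θ i x) = mean l H' θ) ∧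
        boxIntegral (mean l H') = boxIntegral (mean l H) := by
  induction s using Finset.induction_on with
  | empty =>
    exact fun η hη => ⟨η, hη, fun H hH hper hc => ⟨H, hH, hper, hc, id, by simp, rfl⟩⟩
  | insert j s hj ih =>
    intro η hη
    rw [Finset.mem_insert, not_or] at hs
    let ρ := min (η / 26) (1 / 24)
    have hρ : 0 < ρ := lt_min (by positivity) (by norm_num)
    obtain ⟨δ, hδ, h⟩ := ih hs.2 (ρ / 64) (by positivity)
    refine ⟨δ, hδ, fun H hH hper hc => ?_⟩
    obtain ⟨H₁, hH₁, hper₁, hc₁, hr₁, hi₁, hb₁⟩ := h H hH hper hc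
    obtain ⟨H₂, hH₂, hper₂, hc₂, hr₂, hm₂⟩ := exists_shear (Ne.symm hs.1) hH₁ hper₁ hρ
      (min_le_right _ _) (by linarith) hc₁
    have hm : ∀ θ, mean l H₂ θ = mean j (mean l H₁) θ := fun θ => by
      rw [hm₂, mean_comm hH₁.continuous hs.1]
    refine ⟨H₂, hH₂, hper₂, fun θ => (hc₂ θ).trans ?_, hr₁ ∘ hr₂, fun i hi θ x => ?_, ?_⟩
    · have : ρ ≤ η / 26 := min_le_left _ _
      linarith
    · rw [hm, hm]
      by_cases hij : i = j
      · subst hij; exact mean_update _ _ _ _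
      · refine mean_congr fun y => ?_
        rw [Function.update_comm hij]
        exact hi₁ i ((Finset.mem_insert.1 hi).resolve_left hij) _ _
    · have hc : Continuous (mean l H₁) := (analyticOnNhd_mean hH₁ l).continuous
      rw [← hb₁, show mean l H₂ = mean j (mean l H₁) from funext hm,
        boxIntegral_mean hc j (analyticOnNhd_mean (analyticOnNhd_mean hH₁ l) j).continuous]

/-- A density with integral zero which is close enough to `osc` is realizable. -/
theorem exists_realizable {l : Fin n} (hl : ∀ i, l ≤ i) :
    ∃ δ > 0, ∀ H : (Fin n → ℝ) → ℂ, AnalyticOnNhd ℝ H univ → IsPeriodic H →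
      (∀ θ, ‖H θ - osc θ‖ ≤ δ) → boxIntegral H = 0 → Realizable H := by
  obtain ⟨δ, hδ, h⟩ := exists_mean_independent l (Finset.univ.erase l) (by simp) (1 / 2)
    (by norm_num)
  refine ⟨δ, hδ, fun H hH hper hc h0 => ?_⟩
  obtain ⟨H', hH', hper', hc', hr, hi, hb⟩ := h H hH hper hc
  refine hr (realizable_of_mean_eq_zero hH' hper' hc' hl fun θ => ?_)
  -- the mean over `θ_l` is independent of all angles, hence equal to the total mean
  have hconst := eq_of_forall_update_eq (f := mean l H') fun i θ x => by
    by_cases hil : i = l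
    · subst hil; exact mean_update _ _ _ _
    · exact hi i (by simp [hil]) θ x
  rw [boxIntegral_mean hH.continuous l (analyticOnNhd_mean hH l).continuous, h0] at hb
  rw [boxIntegral, setIntegral_congr_fun measurableSet_Icc (fun θ' _ => hconst θ' θ),
    setIntegral_const] at hb
  refine (smul_eq_zero.1 hb).resolve_left ?_
  have hvol := Real.volume_Icc_pi_toReal (a := (0 : Fin n → ℝ)) (b := fun _ => 2 * Real.pi)
    (fun i => Real.two_pi_pos.le)
  rw [Measure.real, hvol]
  exact Finset.prod_ne_zero_iff.2 fun i _ => by simp [Real.pi_ne_zero]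

end Reduction

/-! ### Forms, densities and maps of the torus -/

section Forms

variable {n : ℕ}

theorem dTheta_apply (v : Fin n → Fin n → ℝ) : dTheta n v = Matrix.det (Matrix.of v) := rfl

theorem dTheta_single : dTheta n (fun j => Pi.single j 1) = 1 := by
  rw [dTheta_apply, ← Matrix.det_one (n := Fin n)]
  congr 1
  ext i j
  simp [Matrix.one_apply, Pi.single_apply, eq_comm]

theorem omegaOf_apply (φ : Torus n → (Fin n → ℂ)) (θ : Fin n → ℝ) (v : Fin n → Fin n → ℝ) :
    omegaOf φ θ v = (dTheta n v : ℝ) * jac (lift φ) θ := det_of_map _ v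

theorem incl_cover (θ : Fin n → ℝ) (i : Fin n) : incl (cover θ) i = Circle.exp (θ i) := rfl

theorem jac_incl (θ : Fin n → ℝ) : jac (lift (incl (n := n))) θ = Complex.I ^ n * osc θ := by
  have hd : HasFDerivAt (lift (incl (n := n))) (ContinuousLinearMap.pi fun i =>
      (ContinuousLinearMap.proj (R := ℝ) (φ := fun _ : Fin n => ℝ) i).smulRight
        ((Circle.exp (θ i) : ℂ) * Complex.I)) θ := by
    rw [hasFDerivAt_pi]
    intro i
    have h := (hasDerivAt_circleExp (θ i)).hasFDerivAt.comp θ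
      (ContinuousLinearMap.proj (R := ℝ) (φ := fun _ : Fin n => ℝ) i).hasFDerivAt
    refine h.congr_fderiv ?_
    ext v
    simp
  have hm : (Matrix.of fun k => fderiv ℝ (lift (incl (n := n))) θ (Pi.single k 1)) =
      Matrix.diagonal fun i => (Circle.exp (θ i) : ℂ) * Complex.I := by
    ext k i
    rw [hd.fderiv]
    by_cases h : k = i
    · subst h; simp
    · simp [h, Ne.symm h]
  rw [jac, hm, Matrix.det_diagonal, Finset.prod_mul_distrib, Finset.prod_const, Finset.card_univ,
    Fintype.card_fin, osc, mul_comm]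

/-- The density of the form `(1 + a) Ω`, up to the constant `iⁿ`. -/
noncomputable def density (a : (Fin n → ℂ) → ℂ) (θ : Fin n → ℝ) : ℂ :=
  (1 + a (incl (cover θ))) * osc θ

theorem perturbedForm_apply (a : (Fin n → ℂ) → ℂ) (θ : Fin n → ℝ) (v : Fin n → Fin n → ℝ) :
    perturbedForm a θ v = (dTheta n v : ℝ) * (Complex.I ^ n * density a θ) := by
  have h : perturbedForm a θ v = (1 + a (incl (cover θ))) * omegaOf incl θ v := rfl
  rw [h, omegaOf_apply, jac_incl, density]
  ring

theorem boxIntegral_density {a : (Fin n → ℂ) → ℂ} (h : integral (perturbedForm a) = 0) :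
    boxIntegral (density a) = 0 := by
  simp only [integral, perturbedForm_apply, dTheta_single, Complex.ofReal_one, one_mul,
    integral_const_mul] at h
  exact (mul_eq_zero.1 h).resolve_left (pow_ne_zero _ Complex.I_ne_zero)

theorem injective_of_det_ne_zero {L : (Fin n → ℝ) →L[ℝ] (Fin n → ℂ)}
    (h : Matrix.det (Matrix.of fun k => L (Pi.single k 1)) ≠ 0) : Function.Injective L := by
  rw [injective_iff_map_eq_zero]
  intro v hv
  have h1 := LinearMap.pi_apply_eq_sum_univ (L : (Fin n → ℝ) →ₗ[ℝ] (Fin n → ℂ)) v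
  have h2 : ∀ k : Fin n, (fun j => if k = j then (1 : ℝ) else 0) = Pi.single k 1 := by
    intro k; ext j; simp [Pi.single_apply, eq_comm]
  simp only [h2] at h1
  change L v = ∑ k : Fin n, v k • L (Pi.single k (1 : ℝ)) at h1
  have h3 : Matrix.vecMul (fun k => (v k : ℂ)) (Matrix.of fun k => L (Pi.single k 1)) = 0 := by
    rw [← hv, h1]
    ext i
    simp [Matrix.vecMul, dotProduct, Finset.sum_apply]
  have h4 := Matrix.eq_zero_of_vecMul_eq_zero h h3
  ext k
  simpa using congrFun h4 k

/-- The map of the torus given in angular coordinates by a periodic function. -/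
noncomputable def descend {X : Type*} (φ : (Fin n → ℝ) → X) (p : Torus n) : X :=
  φ fun j => Complex.arg (p j)

theorem cover_arg (p : Torus n) : cover (fun j => Complex.arg (p j)) = p :=
  funext fun j => Circle.exp_arg (p j)

theorem lift_descend {X : Type*} {φ : (Fin n → ℝ) → X} (hφ : IsPeriodic φ) :
    lift (descend φ) = φ := funext fun θ => hφ _ _ (cover_arg (cover θ))

theorem continuous_cover : Continuous (cover (n := n)) :=
  continuous_pi fun j => Circle.exp.continuous.comp (continuous_apply j)

/-- The torus carries the quotient topology of the angular coordinates. -/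
theorem continuous_of_lift {X : Type*} [TopologicalSpace X] {f : Torus n → X}
    (h : Continuous (lift f)) : Continuous f := by
  let B := Icc (fun _ : Fin n => -Real.pi) (fun _ => Real.pi)
  have hB : CompactSpace B := isCompact_iff_compactSpace.1 isCompact_Icc
  let q : B → Torus n := fun θ => cover θ
  have hqc : Continuous q := continuous_cover.comp continuous_subtype_val
  have hqs : Function.Surjective q := fun p =>
    ⟨⟨fun j => Complex.arg (p j), fun j => (Complex.neg_pi_lt_arg _).le,
      fun j => Complex.arg_le_pi _⟩, cover_arg p⟩
  rw [(IsQuotientMap.of_surjective_continuous hqs hqc).continuous_iff]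
  exact h.comp continuous_subtype_val

/-- A nowhere vanishing realizable density comes from a real analytic embedding. -/
theorem Realizable.exists_embedding {H : (Fin n → ℝ) → ℂ} (h : Realizable H)
    (hne : ∀ θ, H θ ≠ 0) :
    ∃ φ : Torus n → (Fin n → ℂ), IsAnalyticEmbedding φ ∧ IsTotallyReal φ ∧
      ∀ θ v, omegaOf φ θ v = (dTheta n v : ℝ) * (Complex.I ^ n * H θ) := by
  obtain ⟨φ, hφa, hφj, hφi⟩ := h
  have hlift : lift (descend φ) = φ := lift_descend fun θ θ' => (hφi θ θ').2
  have hjac : ∀ θ, jac φ θ ≠ 0 := fun θ => by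
    rw [hφj]; exact mul_ne_zero (pow_ne_zero _ Complex.I_ne_zero) (hne θ)
  have hω : ∀ θ v, omegaOf (descend φ) θ v = (dTheta n v : ℝ) * (Complex.I ^ n * H θ) :=
    fun θ v => by rw [omegaOf_apply, hlift, hφj]
  refine ⟨descend φ, ⟨?_, fun θ => ?_, ?_⟩, fun θ h0 => ?_, hω⟩
  · rwa [hlift]
  · rw [differential, hlift]
    exact injective_of_det_ne_zero (hjac θ)
  · have hc : Continuous (descend φ) := continuous_of_lift (by rw [hlift]; exact hφa.continuous)
    refine (hc.isClosedEmbedding fun p p' hp => ?_).isEmbedding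
    rw [← cover_arg p, ← cover_arg p']
    exact (hφi _ _).1 hp
  · have h1 := hω θ (fun j => Pi.single j 1)
    rw [h0, dTheta_single, ← hφj] at h1
    simp only [AlternatingMap.zero_apply, Complex.ofReal_one, one_mul] at h1
    exact hjac θ h1.symm

end Forms

/-! ### The phase of the perturbed form -/

section Phase

variable {n : ℕ}

/-- A circle-valued map with a real analytic angle function without critical points is a
submersion. -/
theorem isSubmersion_of_angle {τ : Torus n → Circle} {μ : (Fin n → ℝ) → ℝ}
    (hμ : AnalyticOnNhd ℝ μ univ) (hτ : ∀ θ, τ (cover θ) = Circle.exp (μ θ))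
    (hne : ∀ θ, ∃ v, fderiv ℝ μ θ v ≠ 0) : IsSubmersion τ := by
  have hl : (lift fun p => (τ p : ℂ)) = fun θ => (Circle.exp (μ θ) : ℂ) :=
    funext fun θ => by simp [lift, hτ]
  refine ⟨?_, fun θ => ?_⟩
  · rw [hl]
    have : AnalyticOnNhd ℝ (fun θ => (Circle.exp (μ θ) : ℂ)) univ := fun θ hθ =>
      analyticAt_circleExp (hμ θ hθ)
    exact this.contDiff
  · have hd : ∀ v, fderiv ℝ (lift fun p => (τ p : ℂ)) θ v =
        fderiv ℝ μ θ v • (Complex.I * (τ (cover θ) : ℂ)) := by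
      intro v
      have h := (hasDerivAt_circleExp (μ θ)).hasFDerivAt.comp θ
        (hμ θ trivial).differentiableAt.hasFDerivAt
      have h2 : fderiv ℝ (lift fun p => (τ p : ℂ)) θ =
          fderiv ℝ ((fun x : ℝ => (Circle.exp x : ℂ)) ∘ μ) θ := by rw [hl]; rfl
      rw [h2, h.fderiv, hτ]
      simp [mul_comm Complex.I]
    obtain ⟨v, hv⟩ := hne θ
    apply le_antisymm
    · rintro _ ⟨u, rfl⟩
      rw [ContinuousLinearMap.coe_coe, hd]
      exact Submodule.smul_mem _ _ (Submodule.mem_span_singleton_self _)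
    · rw [Submodule.span_singleton_le_iff_mem]
      refine ⟨(fderiv ℝ μ θ v)⁻¹ • v, ?_⟩
      rw [ContinuousLinearMap.coe_coe, map_smul, hd, smul_smul, inv_mul_cancel₀ hv, one_smul]

theorem prod_cover (θ : Fin n → ℝ) : ∏ i, cover θ i = Circle.exp (∑ i, θ i) := by
  have h : ∀ s : Finset (Fin n), ∏ i ∈ s, cover θ i = Circle.exp (∑ i ∈ s, θ i) := by
    intro s
    induction s using Finset.induction_on with
    | empty => simp
    | insert j s hj ih => rw [Finset.prod_insert hj, Finset.sum_insert hj, ih, Circle.exp_add]; rfl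
  exact h _

theorem osc_eq_exp (θ : Fin n → ℝ) : osc θ = Circle.exp (∑ i, θ i) := by
  rw [osc, Circle.coe_exp, Complex.ofReal_sum, Finset.sum_mul, Complex.exp_sum]
  rfl

theorem isOpen_annulus (n : ℕ) (r : ℝ) : IsOpen (annulus n r) := by
  have h : annulus n r = ⋂ j, {z : Fin n → ℂ | Real.exp (-r) < ‖z j‖ ∧ ‖z j‖ < Real.exp r} := by
    ext z; simp [annulus]
  rw [h]
  refine isOpen_iInter_of_finite fun j => ?_
  have hc : Continuous fun z : Fin n → ℂ => ‖z j‖ := by fun_prop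
  exact (isOpen_lt continuous_const hc).inter (isOpen_lt hc continuous_const)

theorem norm_le_of_annulusNorm_le {r C : ℝ} (hC : 0 ≤ C) {a : (Fin n → ℂ) → ℂ}
    (h : annulusNorm r a ≤ ENNReal.ofReal C) {z : Fin n → ℂ} (hz : z ∈ annulus n r) :
    ‖a z‖ ≤ C := by
  have h1 : ‖a z‖ₑ ≤ ENNReal.ofReal C := (le_iSup₂ (f := fun z _ => ‖a z‖ₑ) z hz).trans h
  rwa [← ofReal_norm, ENNReal.ofReal_le_ofReal_iff hC] at h1

/-- The polydiscs of radius `r / 4` about points of the torus lie in the annulus. -/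
theorem mem_annulus_of_near {r : ℝ} (hr : 0 < r) (hr1 : r < 1) {z : Fin n → ℂ}
    (h : ∀ i, ∃ u : Circle, ‖z i - u‖ ≤ r / 4) : z ∈ annulus n r := by
  intro i
  obtain ⟨u, hu⟩ := h i
  have h1 : |‖z i‖ - ‖(u : ℂ)‖| ≤ r / 4 := (abs_norm_sub_norm_le _ _).trans hu
  rw [Circle.norm_coe, abs_le] at h1
  have h2 := Real.add_one_le_exp r
  have h3 : Real.exp (-r) * Real.exp r = 1 := by rw [← Real.exp_add]; simp
  constructor
  · have h4 : Real.exp (-r) * (1 + r) ≤ 1 := by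
      rw [← h3]; gcongr; linarith
    have h5 : Real.exp (-r) < 1 - r / 4 := by
      by_contra hcon
      rw [not_lt] at hcon
      nlinarith
    linarith [h1.1]
  · linarith [h1.2]

theorem incl_mem_annulus {r : ℝ} (hr : 0 < r) (hr1 : r < 1) (p : Torus n) :
    incl p ∈ annulus n r :=
  mem_annulus_of_near hr hr1 fun i => ⟨p i, by simp [incl]; linarith⟩

theorem analyticAt_restrict {r : ℝ} (hr : 0 < r) (hr1 : r < 1) {a : (Fin n → ℂ) → ℂ}
    (ha : DifferentiableOn ℂ a (annulus n r)) (θ : Fin n → ℝ) :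
    AnalyticAt ℝ (fun θ => a (incl (cover θ))) θ := by
  have h1 := analyticOnNhd_of_differentiableOn (isOpen_annulus n r) ha _
    (incl_mem_annulus hr hr1 (cover θ))
  have h2 : AnalyticAt ℝ (fun θ : Fin n → ℝ => incl (cover θ)) θ := AnalyticAt.pi fun i =>
    analyticAt_circleExp (analyticAt_coord analyticAt_id i)
  exact AnalyticAt.comp (g := a) h1 h2

/-- Cauchy's estimate for the derivative with respect to one angle. -/
theorem exists_hasDerivAt_restrict {r ε : ℝ} (hr : 0 < r) (hr1 : r < 1)
    {a : (Fin n → ℂ) → ℂ} (ha : DifferentiableOn ℂ a (annulus n r))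
    (hb : ∀ z ∈ annulus n r, ‖a z‖ ≤ ε * r) (l : Fin n) (θ : Fin n → ℝ) :
    ∃ c : ℂ, ‖c‖ ≤ 4 * ε ∧
      HasDerivAt (fun x => a (incl (cover (Function.update θ l x)))) c (θ l) := by
  let g : ℂ → ℂ := fun ζ => a (Function.update (incl (cover θ)) l ζ)
  have hmem : ∀ ζ ∈ Metric.closedBall (Circle.exp (θ l) : ℂ) (r / 4),
      Function.update (incl (cover θ)) l ζ ∈ annulus n r := fun ζ hζ =>
    mem_annulus_of_near hr hr1 fun i => ⟨Circle.exp (θ i), by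
      by_cases hi : i = l
      · subst hi; simpa using mem_closedBall_iff_norm.1 hζ
      · rw [Function.update_of_ne hi, incl_cover, sub_self, norm_zero]; positivity⟩
  have hg : ∀ ζ ∈ Metric.closedBall (Circle.exp (θ l) : ℂ) (r / 4), DifferentiableAt ℂ g ζ := by
    intro ζ hζ
    have h1 := ha.differentiableAt ((isOpen_annulus n r).mem_nhds (hmem ζ hζ))
    exact DifferentiableAt.comp ζ h1 (hasDerivAt_update (incl (cover θ)) l ζ).differentiableAt
  have hgd : DifferentiableOn ℂ g (Metric.closedBall (Circle.exp (θ l) : ℂ) (r / 4)) :=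
    fun ζ hζ => (hg ζ hζ).differentiableWithinAt
  have h1 : ‖deriv g (Circle.exp (θ l) : ℂ)‖ ≤ ε * r / (r / 4) := by
    refine Complex.norm_deriv_le_of_forall_mem_sphere_norm_le (by positivity) ?_ fun ζ hζ =>
      hb _ (hmem ζ (Metric.sphere_subset_closedBall hζ))
    exact hgd.diffContOnCl_ball le_rfl
  have h2 : ε * r / (r / 4) = 4 * ε := by field_simp
  rw [h2] at h1
  have h3 := (hg _ (Metric.mem_closedBall_self (by positivity))).hasDerivAt
  refine ⟨_, ?_, (h3.comp_of_eq (θ l) (hasDerivAt_circleExp (θ l)) rfl).congr_of_eventuallyEq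
    (Eventually.of_forall fun x => ?_)⟩
  · rw [norm_mul, norm_mul, Circle.norm_coe, Complex.norm_I, mul_one, mul_one]
    exact h1
  · simp only [Function.comp, g]
    congr 1
    ext i
    by_cases hi : i = l
    · subst hi; simp [incl_cover]
    · simp [incl_cover, hi]

/-- The phase of `(1 + a) Ω` on the torus is a submersion: its derivative with respect to `θ_l`
is `1 + Im (∂_l a / (1 + a)) > 0`. -/
theorem isNonCritical_of_small (l : Fin n) {r ε : ℝ} (hr : 0 < r) (hr1 : r < 1)
    (hε : ε ≤ 1 / 8) {a : (Fin n → ℂ) → ℂ} (ha : DifferentiableOn ℂ a (annulus n r))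
    (hb : ∀ z ∈ annulus n r, ‖a z‖ ≤ ε * r) {φ : Torus n → (Fin n → ℂ)}
    (hφ : perturbedForm a = omegaOf φ) : IsNonCritical φ := by
  have hasmall : ∀ p, ‖a (incl p)‖ ≤ 1 / 8 := fun p => by
    have := hb _ (incl_mem_annulus hr hr1 p)
    nlinarith [mul_le_mul_of_nonneg_right hε hr.le]
  have hslit : ∀ p, 1 + a (incl p) ∈ Complex.slitPlane := fun p => by
    left
    have h1 := (abs_le.1 (Complex.abs_re_le_norm (a (incl p)))).1
    have h2 := hasmall p
    simp only [Complex.add_re, Complex.one_re]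
    linarith
  let μ : (Fin n → ℝ) → ℝ := fun θ =>
    n * (Real.pi / 2) + ∑ i, θ i + (Complex.log (1 + a (incl (cover θ)))).im
  have hμa : AnalyticOnNhd ℝ μ univ := by
    intro θ _
    have h1 : AnalyticAt ℝ (fun θ => Complex.log (1 + a (incl (cover θ)))) θ :=
      AnalyticAt.comp (g := Complex.log) (analyticAt_clog (hslit _)).restrictScalars
        (analyticAt_const.add (analyticAt_restrict hr hr1 ha θ))
    refine AnalyticAt.add (analyticAt_const.add ?_) ((Complex.imCLM.analyticAt _).comp h1)
    exact Finset.analyticAt_fun_sum _ fun i _ => analyticAt_coord analyticAt_id i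
  refine ⟨fun p => Circle.exp (n * (Real.pi / 2)) * (∏ i, p i) *
    Circle.exp (Complex.log (1 + a (incl p))).im, fun p => ‖1 + a (incl p)‖, fun p => ?_,
    fun θ v => ?_, isSubmersion_of_angle hμa (fun θ => ?_) fun θ => ⟨Pi.single l 1, ?_⟩⟩
  · exact norm_pos_iff.2 (Complex.slitPlane_ne_zero (hslit p))
  · have h1 : ((‖1 + a (incl (cover θ))‖ : ℝ) : ℂ) *
        (Circle.exp (Complex.log (1 + a (incl (cover θ)))).im : ℂ) = 1 + a (incl (cover θ)) := by
      rw [Complex.log_im, Circle.coe_exp, Complex.norm_mul_exp_arg_mul_I]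
    have h2 : (Circle.exp (n * (Real.pi / 2)) : ℂ) = Complex.I ^ n := by
      rw [Circle.coe_exp]
      push_cast
      rw [mul_assoc, Complex.exp_nat_mul, Complex.exp_pi_div_two_mul_I]
    rw [← hφ, perturbedForm_apply, density, Circle.coe_mul, Circle.coe_mul, h2, prod_cover,
      ← osc_eq_exp, Complex.ofReal_mul]
    linear_combination (-((dTheta n v : ℝ) : ℂ) * Complex.I ^ n * osc θ) * h1
  · simp only [μ, Circle.exp_add, prod_cover]
  · obtain ⟨c, hc, hcd⟩ := exists_hasDerivAt_restrict hr hr1 ha hb l θ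
    have h1 : HasDerivAt (fun x => μ (Function.update θ l x))
        (1 + (c / (1 + a (incl (cover θ)))).im) (θ l) := by
      have hs : HasDerivAt (fun x : ℝ => ∑ i, Function.update θ l x i) 1 (θ l) := by
        have h := HasDerivAt.fun_sum (u := Finset.univ) fun i _ =>
          hasDerivAt_pi.1 (hasDerivAt_update θ l (θ l)) i
        simpa using h
      have hl : HasDerivAt (fun x : ℝ =>
          Complex.log (1 + a (incl (cover (Function.update θ l x)))))
          (c / (1 + a (incl (cover θ)))) (θ l) := by
        have h := (hcd.const_add 1).clog_real (by
          rw [Function.update_eq_self]; exact hslit (cover θ))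
        rwa [Function.update_eq_self] at h
      exact (hs.const_add _).add (Complex.imCLM.hasFDerivAt.comp_hasDerivAt (θ l) hl)
    have h2 : HasFDerivAt μ (fderiv ℝ μ θ) (Function.update θ l (θ l)) := by
      rw [Function.update_eq_self]; exact (hμa θ trivial).differentiableAt.hasFDerivAt
    have h3 := (h2.comp_hasDerivAt _ (hasDerivAt_update θ l (θ l))).unique h1
    rw [h3]
    have h4 : 7 / 8 ≤ ‖1 + a (incl (cover θ))‖ := by
      have h5 := norm_sub_norm_le (1 : ℂ) (-a (incl (cover θ)))
      rw [sub_neg_eq_add, norm_neg, norm_one] at h5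
      linarith [hasmall (cover θ)]
    have h6 : ‖c / (1 + a (incl (cover θ)))‖ < 1 := by
      rw [norm_div, div_lt_one (by linarith)]
      linarith
    have h7 := (abs_lt.1 ((Complex.abs_im_le_norm _).trans_lt h6)).1
    intro h8
    linarith

end Phase

end UnimodularTorus

open UnimodularTorus in
theorem theorem1p4 (n : ℕ) (hn : 1 ≤ n) :
    ∃ ε : ℝ, 0 < ε ∧
      ∀ r₀ : ℝ, 0 < r₀ → r₀ < 1 →
        ∀ a : (Fin n → ℂ) → ℂ,
          DifferentiableOn ℂ a (annulus n r₀) →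
          integral (perturbedForm a) = 0 →
          annulusNorm r₀ a ≤ ENNReal.ofReal (ε * r₀) →
          ∃ φ : Torus n → (Fin n → ℂ),
            IsAnalyticEmbedding φ ∧ IsTotallyReal φ ∧ IsNonCritical φ ∧
              perturbedForm a = omegaOf φ := by
  let l : Fin n := ⟨0, hn⟩
  obtain ⟨δ, hδ, hreal⟩ := exists_realizable (l := l) fun i => Nat.zero_le _
  have hε : 0 < min δ (1 / 8) := lt_min hδ (by norm_num)
  refine ⟨min δ (1 / 8), hε, fun r₀ hr hr1 a ha hint hnorm => ?_⟩
  have hb : ∀ z ∈ annulus n r₀, ‖a z‖ ≤ min δ (1 / 8) * r₀ := fun z hz =>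
    norm_le_of_annulusNorm_le (by positivity) hnorm hz
  have hsmall : ∀ θ, ‖density a θ - osc θ‖ ≤ min δ (1 / 8) := fun θ => by
    have h1 : density a θ - osc θ = a (incl (cover θ)) * osc θ := by rw [density]; ring
    rw [h1, norm_mul, norm_osc, mul_one]
    have h2 := hb _ (incl_mem_annulus hr hr1 (cover θ))
    nlinarith
  have hper : IsPeriodic (density a) := fun θ θ' h => by
    rw [density, density, h, isPeriodic_osc θ θ' h]
  have hana : AnalyticOnNhd ℝ (density a) Set.univ := fun θ hθ =>
    (analyticAt_const.add (analyticAt_restrict hr hr1 ha θ)).mul (analyticOnNhd_osc θ hθ)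
  have hne : ∀ θ, density a θ ≠ 0 := fun θ h0 => by
    have h1 := (hsmall θ).trans (min_le_right _ _)
    rw [h0, zero_sub, norm_neg, norm_osc] at h1
    norm_num at h1
  obtain ⟨φ, hφ, htr, hω⟩ := (hreal (density a) hana hper
    (fun θ => (hsmall θ).trans (min_le_left _ _)) (boxIntegral_density hint)).exists_embedding hne
  have hform : perturbedForm a = omegaOf φ := by
    funext θ
    ext v
    rw [perturbedForm_apply, hω]
  exact ⟨φ, hφ, htr,
    isNonCritical_of_small l hr hr1 (min_le_right _ _) ha hb hform, hform⟩
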